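/- Let $X$ be a separable complex Fréchet space (a complete metrizable locally convex space), $L(X)$ the space of continuous linear operators on $X$, and $T : D(T) \to X$ a densely defined linear operator on $X$ (with $D(T) \subseteq X$ a linear subspace). Let $T^0 = I$ and $D(T^{n+1}) = \{x \in D(T^n) : T^n x \in D(T)\}$, $T^{n+1}x = T(T^n x)$; let $D_\infty(T) = \bigcap_{n} D(T^n)$, and let $[D_\infty(T)]$ be this space with the projective limit topology of the graph topologies, i.e. the topology generated by the seminorms $x \mapsto p(x) + p(Tx) + \dots + p(T^k x)$, where $k \ge 0$ and $p$ runs through the continuous seminorms of $X$. Suppose that $\rho(T) \ne \emptyset$, i.e. there is $\lambda \in \mathbb{C}$ such that $\lambda - T : D(T) \to X$ is bijective with inverse in $L(X)$. Let $J$ be a non-empty set and, for each $j \in J$, let $E_j : \mathbb{T} = \{z \in \mathbb{C} : |z| = 1\} \to X$ be a map with $E_j(z) \in D(T)$ and $T E_j(z) = z E_j(z)$ for all $z \in \mathbb{T}$, such that $\operatorname{span}\{E_j(z) : z \in \mathbb{T},\ j \in J\}$ is dense in $X$. Suppose that there is a sequence $(D_s)_{s \in \mathbb{N}}$ in $L(X)$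 such that $D_s T \subseteq T D_s$ for all $s$ (that is, $D_s x \in D(T)$ and $T D_s x = D_s T x$ for every $x \in D(T)$), $T^n D_s \in L(X)$ for all $s, n \in \mathbb{N}$ (in particular, the range $R(D_s)$ is contained in $D(T^n)$), and $\bigcup_{s \in \mathbb{N}} R(D_s)$ is dense in $[D_\infty(T)]$. (a) If every $E_j$ is continuous, then $T$ is topologically mixing and chaotic. (b) If every $E_j$ is $C^2$ (that is, $t \mapsto E_j(e^{it})$ is twice continuously differentiable as an $X$-valued map on $\mathbb{R}$), then $T$ is frequently hypercyclic. Here $T$ is topologically mixing if for all non-empty open $U, V \subseteq X$ there is $n_0$ such that $T^n(U \cap D(T^n)) \cap V \neq \emptyset$ for all $n \ge n_0$; $T$ is chaotic if some $x \in D_\infty(T)$ has a dense orbit $\{T^n x : n \ge 0\}$ and the set of $x \in D_\infty(T)$ with $T^n x = x$ for some $n \ge 1$ is dense in $X$; $T$ is frequently hypercyclic if there is $x \in D_\infty(T)$ such that for every non-empty open $V \subseteq X$ the set $A = \{n : T^n x \in V\}$ has positive lower density, $\liminf_{N \to \infty} |A \cap [1, N]| / N > 0$. -/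

import Mathlib

open Filter Topology

namespace LinearPMap

/-- The composition `S ∘ T` of two partially defined linear operators, with its natural domain
`{x ∈ D(T) : T x ∈ D(S)}`. -/
def pcomp {X : Type*} [AddCommGroup X] [Module ℂ X] (S T : X →ₗ.[ℂ] X) : X →ₗ.[ℂ] X where
  domain := (S.domain.comap T.toFun).map T.domain.subtype
  toFun :=
    { toFun := fun x => S ⟨T ⟨x, by obtain ⟨y, -, hy⟩ := x.2; exact hy ▸ y.2⟩, by
        obtain ⟨x, y, hy, rfl⟩ := x
        exact hy⟩
      map_add' := fun x y => by
        rw [← S.map_add]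
        congr 1
        exact Subtype.ext (T.map_add ⟨x, _⟩ ⟨y, _⟩)
      map_smul' := fun c x => by
        rw [RingHom.id_apply, ← S.map_smul]
        congr 1
        exact Subtype.ext (T.map_smul c ⟨x, _⟩) }

/-- The powers of an operator: `T⁰ = I` on all of `X`, and `Tⁿ⁺¹ = T ∘ Tⁿ` on the natural domain
`D(Tⁿ⁺¹) = {x ∈ D(Tⁿ) : Tⁿ x ∈ D(T)}`. -/
def iter {X : Type*} [AddCommGroup X] [Module ℂ X] (T : X →ₗ.[ℂ] X) : ℕ → (X →ₗ.[ℂ] X)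
  | 0 => LinearMap.toPMap LinearMap.id ⊤
  | n + 1 => pcomp T (iter T n)

/-- `D_∞(T) = ⋂ₙ D(Tⁿ)`. -/
def domInfty {X : Type*} [AddCommGroup X] [Module ℂ X] (T : X →ₗ.[ℂ] X) : Submodule ℂ X :=
  ⨅ n, (T.iter n).domain

theorem domInfty_le {X : Type*} [AddCommGroup X] [Module ℂ X] (T : X →ₗ.[ℂ] X) (n : ℕ) :
    T.domInfty ≤ (T.iter n).domain :=
  iInf_le _ n

/-- `Tⁿ` restricted to `D_∞(T)`, as a linear map into `X`. -/
def powInfty {X : Type*} [AddCommGroup X] [Module ℂ X] (T : X →ₗ.[ℂ] X) (n : ℕ) :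
    T.domInfty →ₗ[ℂ] X :=
  (T.iter n).toFun ∘ₗ Submodule.inclusion (T.domInfty_le n)

/-- The topology of `[D_∞(T)]`, the projective limit of the spaces `[D(Tᵏ)]` with their graph
topologies. If the seminorms `pₙ` generate the topology of `X`, this is the topology generated by
the seminorms `x ↦ pₙ(x) + pₙ(T x) + ⋯ + pₙ(Tᵏ x)`, that is, the coarsest topology for which every
`Tᵏ : D_∞(T) → X` (`k = 0, 1, 2, …`) is continuous. -/
abbrev domInftyTopology {X : Type*} [AddCommGroup X] [Module ℂ X] [TopologicalSpace X]
    (T : X →ₗ.[ℂ] X) : TopologicalSpace T.domInfty :=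
  ⨅ k : ℕ, TopologicalSpace.induced (T.powInfty k) inferInstance

/-- The resolvent set `ρ(T)`: all `c ∈ ℂ` such that `c - T : D(T) → X` is bijective with an inverse
that belongs to `L(X)`. -/
def resolventSet {X : Type*} [AddCommGroup X] [Module ℂ X] [TopologicalSpace X]
    (T : X →ₗ.[ℂ] X) : Set ℂ :=
  {c | ∃ R : X →L[ℂ] X,
    (∀ x : X, ∃ h : R x ∈ T.domain, c • R x - T ⟨R x, h⟩ = x) ∧
    (∀ x : T.domain, R (c • (x : X) - T x) = x)}

/-- `T` is hypercyclic: some `x ∈ D_∞(T)` has a dense orbit `{Tⁿ x : n = 0, 1, 2, …}`. -/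
def IsHypercyclic {X : Type*} [AddCommGroup X] [Module ℂ X] [TopologicalSpace X]
    (T : X →ₗ.[ℂ] X) : Prop :=
  ∃ x : T.domInfty, Dense (Set.range fun n : ℕ => T.powInfty n x)

/-- `T` is topologically mixing: for all nonempty open `U`, `V`, one has `Tⁿ(U) ∩ V ≠ ∅` for all
large `n`, where `Tⁿ(U)` is the image under `Tⁿ` of `U ∩ D(Tⁿ)`. -/
def IsTopologicallyMixing {X : Type*} [AddCommGroup X] [Module ℂ X] [TopologicalSpace X]
    (T : X →ₗ.[ℂ] X) : Prop :=
  ∀ U V : Set X, IsOpen U → U.Nonempty → IsOpen V → V.Nonempty →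
    ∃ n₀ : ℕ, ∀ n ≥ n₀, ∃ x : (T.iter n).domain, (x : X) ∈ U ∧ T.iter n x ∈ V

/-- The periodic points of `T`: all `x ∈ D_∞(T)` with `Tⁿ x = x` for some `n ≥ 1`. -/
def periodicPoints {X : Type*} [AddCommGroup X] [Module ℂ X] (T : X →ₗ.[ℂ] X) : Set X :=
  {x | ∃ h : x ∈ T.domInfty, ∃ n : ℕ, 1 ≤ n ∧ T.powInfty n ⟨x, h⟩ = x}

/-- `T` is chaotic: hypercyclic with a dense set of periodic points. -/
def IsChaotic {X : Type*} [AddCommGroup X] [Module ℂ X] [TopologicalSpace X]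
    (T : X →ₗ.[ℂ] X) : Prop :=
  T.IsHypercyclic ∧ Dense T.periodicPoints

end LinearPMap

/-- The lower density `liminf |A ∩ [1, n]| / n` of a set of natural numbers. -/
noncomputable def natLowerDensity (A : Set ℕ) : ℝ :=
  liminf (fun n : ℕ => ((A ∩ Set.Icc 1 n).ncard : ℝ) / n) atTop

/-- `T` is frequently hypercyclic: for some `x ∈ D_∞(T)` and all nonempty open `V`, the set
`{n : Tⁿ x ∈ V}` has positive lower density. -/
def LinearPMap.IsFrequentlyHypercyclic {X : Type*} [AddCommGroup X] [Module ℂ X]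
    [TopologicalSpace X] (T : X →ₗ.[ℂ] X) : Prop :=
  ∃ x : T.domInfty, ∀ V : Set X, IsOpen V → V.Nonempty →
    0 < natLowerDensity {n : ℕ | T.powInfty n x ∈ V}

/-- The curve `f : ℝ → X` in a topological vector space is differentiable with derivative `f'`: at
every `t`, the difference quotients `(u - t)⁻¹ (f(u) - f(t))` tend to `f'(t)` as `u → t`. -/
def HasCurveDeriv {X : Type*} [AddCommGroup X] [Module ℂ X] [TopologicalSpace X]
    (f f' : ℝ → X) : Prop :=
  ∀ t : ℝ, Tendsto (slope f t) (𝓝[≠] t) (𝓝 (f' t))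

/-- A map `E` from the unit circle to a topological vector space is `C²` if the curve
`t ↦ E(e^{it})` is twice continuously differentiable. -/
def IsCircleC2 {X : Type*} [AddCommGroup X] [Module ℂ X] [TopologicalSpace X]
    (E : Circle → X) : Prop :=
  ∃ f' f'' : ℝ → X, HasCurveDeriv (fun t : ℝ => E (Circle.exp t)) f' ∧
    HasCurveDeriv f' f'' ∧ Continuous f''

/-! The unbounded operator is replaced by a continuous one. Let `Y` be the space of forward orbits
`(x, T x, T² x, …)` in `ℕ → X`. A nonempty resolvent set makes the graph of `T` closed, so `Y` is
closed in the product, hence complete. It is a copy of `[D_∞(T)]`, and `T` acts on it as the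
continuous shift. Since all `Tⁿ D_s` are continuous, `D_s` lifts to a continuous `L_s : X → Y`. As
`D_s` commutes with `T`, the fields `L_s ∘ E_j` consist of eigenvectors of the shift, and density of
`⋃ R(D_s)` in `[D_∞(T)]` makes their span dense in `Y`. Evaluation at coordinate `0` is continuous
with dense range and carries the dynamics of the shift back to `T`.

For a continuous `S` with eigenvector fields `E` on the circle, the moments `∫ zⁱ E(z) dz`, `i ∈ ℤ`,
form a bi-infinite orbit of `S`. Hahn–Banach and uniqueness of Fourier coefficients show that the
moments span a dense subspace. They tend to zero if `E` is continuous (Riemann–Lebesgue), and are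
absolutely summable if `E` is `C²`, being `O(i⁻²)`.

Null bi-infinite orbits through a dense set give mixing (`topologicallyMixing_of_eigenvectorField`),
and Baire then gives a dense orbit. Eigenvectors at roots of unity give periodic points. Summable
orbits give frequent hypercyclicity (`exists_frequentlyHypercyclic_of_biorbit`): orbit segments are
superposed along the well-separated sets of positive lower density from `exists_separated_sets`. -/

open Filter Topology

/-! ### Continuous seminorms and Hahn–Banach -/

section Seminorms

variable {X : Type*} [AddCommGroup X] [Module ℂ X]

theorem Seminorm.continuous_finset_sup [TopologicalSpace X] {ι : Type*} {p : ι → Seminorm ℂ X}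
    (s : Finset ι) (hp : ∀ i, Continuous (p i)) : Continuous (s.sup p : Seminorm ℂ X) := by
  classical
  induction s using Finset.induction with
  | empty => exact continuous_const (y := (0 : ℝ))
  | insert a s _ ih =>
    rw [Finset.sup_insert]
    exact (hp a).max ih

theorem PolynormableSpace.exists_seminorm_lt_subset [TopologicalSpace X] [PolynormableSpace ℂ X]
    {U : Set X} {x : X} (hU : U ∈ 𝓝 x) :
    ∃ p : Seminorm ℂ X, Continuous p ∧ ∃ r > 0, ∀ y, p (y - x) < r → y ∈ U := by
  have := (PolynormableSpace.withSeminorms ℂ X).topologicalAddGroup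
  obtain ⟨s, r, hr, hs⟩ := ((PolynormableSpace.withSeminorms ℂ X).mem_nhds_iff x U).1 hU
  exact ⟨_, Seminorm.continuous_finset_sup s fun p ↦ p.2, r, hr, fun y hy ↦ hs hy⟩

/-- In a first countable space, an increasing sequence of seminorms suffices. -/
theorem PolynormableSpace.exists_monotone_seminorm [TopologicalSpace X] [PolynormableSpace ℂ X]
    [FirstCountableTopology X] : ∃ q : ℕ → Seminorm ℂ X, (∀ n, Continuous (q n)) ∧ Monotone q ∧
      ∀ U ∈ 𝓝 (0 : X), ∃ n, ∃ r > 0, ∀ y, q n y < r → y ∈ U := by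
  obtain ⟨U, hU⟩ := (𝓝 (0 : X)).exists_antitone_basis
  choose p hp r hr hpU using fun n ↦
    PolynormableSpace.exists_seminorm_lt_subset (hU.toHasBasis.mem_of_mem (i := n) trivial)
  refine ⟨fun n ↦ (Finset.range (n + 1)).sup p, fun n ↦ Seminorm.continuous_finset_sup _ hp,
    fun m n hmn ↦ Finset.sup_mono (Finset.range_mono (by omega)), fun V hV ↦ ?_⟩
  obtain ⟨n, -, hn⟩ := hU.toHasBasis.mem_iff.1 hV
  refine ⟨n, r n, hr n, fun y hy ↦ hn (hpU n y ?_)⟩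
  rw [sub_zero]
  exact (Finset.le_sup (f := p) (Finset.self_mem_range_succ n) y).trans_lt hy

theorem PolynormableSpace.tendsto_nhds [TopologicalSpace X] [PolynormableSpace ℂ X] {ι : Type*}
    {l : Filter ι} {u : ι → X} {x : X} :
    Tendsto u l (𝓝 x) ↔
      ∀ p : Seminorm ℂ X, Continuous p → ∀ ε > 0, ∀ᶠ i in l, p (u i - x) < ε := by
  rw [(PolynormableSpace.withSeminorms ℂ X).tendsto_nhds]
  exact ⟨fun h p hp ↦ h ⟨p, hp⟩, fun h p ↦ h p.1 p.2⟩

theorem PolynormableSpace.cauchySeq_of_seminorm [UniformSpace X] [IsUniformAddGroup X]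
    [PolynormableSpace ℂ X] {u : ℕ → X}
    (h : ∀ p : Seminorm ℂ X, Continuous p → ∀ ε > 0, ∃ N, ∀ m ≥ N, ∀ n ≥ N, p (u m - u n) < ε) :
    CauchySeq u := by
  rw [cauchySeq_iff_tendsto, uniformity_eq_comap_nhds_zero, tendsto_comap_iff,
    PolynormableSpace.tendsto_nhds]
  intro p hp ε hε
  obtain ⟨N, hN⟩ := h p hp ε hε
  filter_upwards [eventually_ge_atTop (N, N)] with ⟨m, n⟩ hmn
  simpa using hN n hmn.2 m hmn.1

/-- A family which is absolutely summable for a family of seminorms that generates a finer topology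
is summable. -/
theorem summable_of_summable_seminorm [UniformSpace X] [IsUniformAddGroup X] [CompleteSpace X]
    {ι κ : Type*} {q : κ → Seminorm ℂ X}
    (hq : ∀ U ∈ 𝓝 (0 : X), ∃ k, ∃ r > 0, ∀ y, q k y < r → y ∈ U) {f : ι → X}
    (h : ∀ k, Summable fun i ↦ q k (f i)) : Summable f := by
  rw [summable_iff_vanishing]
  intro e he
  obtain ⟨k, r, hr, hk⟩ := hq e he
  obtain ⟨s, hs⟩ := summable_iff_vanishing.1 (h k) _ (Metric.ball_mem_nhds 0 hr)
  refine ⟨s, fun t ht ↦ hk _ ?_⟩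
  have := hs t ht
  rw [mem_ball_zero_iff, Real.norm_eq_abs] at this
  exact (Finset.le_sum_of_subadditive (q k) (map_zero _).le (map_add_le_add _) t f).trans_lt
    ((le_abs_self _).trans_lt this)

/-- Hahn–Banach: a continuous functional dominated by `p` and attaining `p w` at `w`. -/
theorem Seminorm.exists_strongDual_eq [TopologicalSpace X] [PolynormableSpace ℂ X]
    {p : Seminorm ℂ X} (hp : Continuous p) (w : X) :
    ∃ φ : StrongDual ℂ X, (∀ x, ‖φ x‖ ≤ p x) ∧ φ w = p w := by
  by_cases hw : w = 0
  · exact ⟨0, by simp, by simp [hw]⟩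
  let f : Module.Dual ℂ (Submodule.span ℂ {w}) :=
    (p w : ℂ) • (LinearEquiv.toSpanNonzeroSingleton ℂ X w hw).symm.toLinearMap
  have hf (c : ℂ) (h) : f ⟨c • w, h⟩ = p w * c := by
    have : (⟨c • w, h⟩ : Submodule.span ℂ {w}) =
      LinearEquiv.toSpanNonzeroSingleton ℂ X w hw c := by ext; simp
    rw [this]
    simp only [f, LinearMap.smul_apply, LinearEquiv.coe_coe, LinearEquiv.symm_apply_apply,
      smul_eq_mul]
  obtain ⟨φ, h1, h2⟩ := Module.Dual.exists_continuous_extension_of_le_seminorm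
    (Submodule.span ℂ {w}) f hp (by
      rintro ⟨x, hx⟩
      obtain ⟨c, rfl⟩ := Submodule.mem_span_singleton.1 hx
      rw [hf]
      simp [map_smul_eq_mul, mul_comm, abs_of_nonneg])
  refine ⟨φ, h2, ?_⟩
  have := h1 ⟨(1 : ℂ) • w, Submodule.smul_mem _ _ (Submodule.mem_span_singleton_self w)⟩
  rw [hf] at this
  simpa using this

/-- Hahn–Banach: a submodule annihilated only by the zero functional is dense. -/
theorem Submodule.dense_of_forall_strongDual_eq_zero [TopologicalSpace X] [PolynormableSpace ℂ X]
    (M : Submodule ℂ X) (h : ∀ φ : StrongDual ℂ X, (∀ x ∈ M, φ x = 0) → φ = 0) :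
    Dense (M : Set X) := by
  have h1 := PolynormableSpace.withSeminorms ℂ X
  have := h1.topologicalAddGroup
  have := h1.continuousSMul
  have : LocallyConvexSpace ℝ X := h1.toLocallyConvexSpace
  have : ContinuousSMul ℝ X := IsScalarTower.continuousSMul (M := ℝ) (α := X) ℂ
  by_contra hd
  obtain ⟨x, hx⟩ : ∃ x, x ∉ closure (M : Set X) := by simpa [Dense] using hd
  obtain ⟨φ, u, hφ, hu⟩ := RCLike.geometric_hahn_banach_closed_point (𝕜 := ℂ)
    ((M.restrictScalars ℝ).convex.closure) isClosed_closure hx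
  have h0 : ∀ y ∈ M, φ y = 0 := by
    intro y hy
    by_contra hne
    -- If `φ y ≠ 0`, a multiple of `y` has the value `‖u‖ + 1 > u`, against the bound on `M`.
    have hlt := hφ ((((‖u‖ + 1 : ℝ) : ℂ) / φ y) • y) (subset_closure (M.smul_mem _ hy))
    rw [map_smul, smul_eq_mul, div_mul_cancel₀ _ hne] at hlt
    have := le_abs_self u
    simp at hlt
    linarith
  have hφ0 := h φ h0
  have hz := hφ 0 (subset_closure M.zero_mem)
  simp only [hφ0] at hz hu
  simp at hz hu
  linarith

end Seminorms

/-! ### Vector-valued means over the circle as limits of Riemann sums -/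

section CircleMean

open Finset in
/-- The Riemann sums of a function on the circle with respect to the `N`-th roots of unity. -/
noncomputable def circleRiemannSum {X : Type*} [AddCommGroup X] [Module ℂ X] (F : Circle → X)
    (N : ℕ) : X :=
  (N : ℂ)⁻¹ • ∑ m ∈ range N, F (Circle.exp (2 * Real.pi * m / N))

/-- The mean value of a function on the circle, as the limit of its Riemann sums. -/
noncomputable def circleMean {X : Type*} [AddCommGroup X] [Module ℂ X] [TopologicalSpace X]
    (F : Circle → X) : X :=
  @limUnder _ _ _ ⟨0⟩ atTop (circleRiemannSum F)

section Algebra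

variable {X : Type*} [AddCommGroup X] [Module ℂ X]

theorem map_circleRiemannSum {Y L : Type*} [AddCommGroup Y] [Module ℂ Y] [FunLike L X Y]
    [LinearMapClass L ℂ X Y] (φ : L) (F : Circle → X) (N : ℕ) :
    φ (circleRiemannSum F N) = circleRiemannSum (fun z ↦ φ (F z)) N := by
  simp [circleRiemannSum]

theorem circleRiemannSum_sub (F G : Circle → X) (N : ℕ) :
    circleRiemannSum (fun z ↦ F z - G z) N = circleRiemannSum F N - circleRiemannSum G N := by
  simp [circleRiemannSum, smul_sub]

theorem seminorm_circleRiemannSum_le (p : Seminorm ℂ X) {F : Circle → X} {C : ℝ}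
    (h : ∀ z, p (F z) ≤ C) (N : ℕ) : p (circleRiemannSum F N) ≤ C := by
  rcases N.eq_zero_or_pos with rfl | hN
  · simpa [circleRiemannSum] using (apply_nonneg p _).trans (h 1)
  rw [circleRiemannSum, map_smul_eq_mul, norm_inv, Complex.norm_natCast,
    inv_mul_le_iff₀ (by positivity)]
  calc _ ≤ ∑ m ∈ Finset.range N, p (F (Circle.exp (2 * Real.pi * m / N))) :=
        Finset.le_sum_of_subadditive p (map_zero p).le (map_add_le_add p) _ _
    _ ≤ ∑ m ∈ Finset.range N, C := Finset.sum_le_sum fun _ _ ↦ h _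
    _ = _ := by simp

theorem circleRiemannSum_rotate_one (F : Circle → X) (N : ℕ) :
    circleRiemannSum (fun z ↦ F (Circle.exp (2 * Real.pi / N) * z)) N = circleRiemannSum F N := by
  rcases N.eq_zero_or_pos with rfl | hN
  · simp [circleRiemannSum]
  have hN' : (N : ℝ) ≠ 0 := by positivity
  have h (m : ℕ) : Circle.exp (2 * Real.pi / N) * Circle.exp (2 * Real.pi * m / N) =
      Circle.exp (2 * Real.pi * (m + 1 : ℕ) / N) := by
    rw [← Circle.exp_add]
    congr 1
    push_cast
    ring
  simp only [circleRiemannSum, h]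
  congr 1
  have := Finset.sum_range_succ (fun m : ℕ ↦ F (Circle.exp (2 * Real.pi * m / N))) N
  rw [Finset.sum_range_succ', mul_div_assoc _ (N : ℝ), div_self hN'] at this
  simpa using this

theorem circleRiemannSum_rotate (F : Circle → X) (N k : ℕ) :
    circleRiemannSum (fun z ↦ F (Circle.exp (2 * Real.pi * k / N) * z)) N =
      circleRiemannSum F N := by
  induction k with
  | zero => simp
  | succ k ih =>
    rw [← ih, ← circleRiemannSum_rotate_one fun z ↦ F (Circle.exp (2 * Real.pi * k / N) * z)]
    congr! 3
    rw [← mul_assoc, ← Circle.exp_add]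
    congr 2
    push_cast
    ring

theorem sum_range_mul_eq_sum_sum {M : Type*} [AddCommMonoid M] (f : ℕ → M) (m n : ℕ) :
    ∑ i ∈ Finset.range (m * n), f i =
      ∑ j ∈ Finset.range n, ∑ i ∈ Finset.range m, f (i * n + j) := by
  rw [Finset.sum_comm]
  induction m with
  | zero => simp
  | succ m ih => rw [Finset.sum_range_succ, ← ih, add_mul, one_mul, Finset.sum_range_add]

/-- The `NM`-th roots of unity split into `M` cosets of the `N`-th roots of unity, rotated by angles
below `2π / N`. -/
theorem circleRiemannSum_mul (F : Circle → X) {N M : ℕ} (hN : 0 < N) (hM : 0 < M) :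
    circleRiemannSum F (N * M) = (M : ℂ)⁻¹ • ∑ r ∈ Finset.range M,
      circleRiemannSum (fun z ↦ F (Circle.exp (2 * Real.pi * r / (N * M)) * z)) N := by
  simp only [circleRiemannSum]
  rw [← Finset.smul_sum, smul_smul, sum_range_mul_eq_sum_sum]
  congr 1
  · rw [Nat.cast_mul, mul_inv, mul_comm]
  · refine Finset.sum_congr rfl fun r _ ↦ Finset.sum_congr rfl fun m _ ↦ ?_
    rw [← Circle.exp_add]
    congr 2
    push_cast
    field_simp
    ring

end Algebra

section Topology

variable {X : Type*} [AddCommGroup X] [Module ℂ X]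

theorem Continuous.exists_forall_seminorm_rotate_sub_lt [TopologicalSpace X]
    [IsTopologicalAddGroup X] {F : Circle → X} (hF : Continuous F) {p : Seminorm ℂ X}
    (hp : Continuous p) {ε : ℝ} (hε : 0 < ε) :
    ∃ δ > 0, ∀ t : ℝ, |t| < δ → ∀ z, p (F (Circle.exp t * z) - F z) < ε := by
  have h : ∀ᶠ t in 𝓝 (0 : ℝ), ∀ z ∈ (Set.univ : Set Circle),
      p (F (Circle.exp t * z) - F z) < ε := by
    refine isCompact_univ.eventually_forall_of_forall_eventually fun z _ ↦ ?_
    have hc : Continuous fun q : ℝ × Circle ↦ p (F (Circle.exp q.1 * q.2) - F q.2) := by fun_prop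
    exact (hc.tendsto (0, z)).eventually_lt_const (by simpa using hε)
  obtain ⟨δ, hδ, h⟩ := Metric.eventually_nhds_iff.1 h
  exact ⟨δ, hδ, fun t ht z ↦ h (by simpa using ht) z trivial⟩

/-- The sums for `N` and `M` are both compared with the sum for `NM`. By `circleRiemannSum_mul` the
latter averages rotations of the coarse sum by small angles, and uniform continuity controls these.
-/
theorem cauchySeq_circleRiemannSum [UniformSpace X] [IsUniformAddGroup X] [PolynormableSpace ℂ X]
    {F : Circle → X} (hF : Continuous F) : CauchySeq (circleRiemannSum F) := by
  refine PolynormableSpace.cauchySeq_of_seminorm fun p hp ε hε ↦ ?_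
  obtain ⟨δ, hδ, h⟩ := hF.exists_forall_seminorm_rotate_sub_lt hp (show 0 < ε / 3 by positivity)
  obtain ⟨K, hK⟩ := exists_nat_gt (2 * Real.pi / δ)
  have key : ∀ N ≥ K + 1, ∀ M ≥ K + 1,
      p (circleRiemannSum F (N * M) - circleRiemannSum F N) ≤ ε / 3 := by
    intro N hN M hM
    have hM0 : (M : ℂ) ≠ 0 := by norm_cast; omega
    have hM1 : (0 : ℝ) < M := by norm_cast; omega
    have hN1 : (0 : ℝ) < N := by norm_cast; omega
    have : circleRiemannSum F (N * M) - circleRiemannSum F N =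
        (M : ℂ)⁻¹ • ∑ r ∈ Finset.range M, circleRiemannSum
          (fun z ↦ F (Circle.exp (2 * Real.pi * r / (N * M)) * z) - F z) N := by
      simp only [circleRiemannSum_sub, Finset.sum_sub_distrib, smul_sub]
      rw [← circleRiemannSum_mul F (by omega) (by omega)]
      simp [← Nat.cast_smul_eq_nsmul ℂ, smul_smul, hM0]
    rw [this, map_smul_eq_mul, norm_inv, Complex.norm_natCast, inv_mul_le_iff₀ hM1]
    calc _ ≤ _ := Finset.le_sum_of_subadditive p (map_zero p).le (map_add_le_add p) _ _
      _ ≤ ∑ r ∈ Finset.range M, ε / 3 := by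
        refine Finset.sum_le_sum fun r hr ↦ seminorm_circleRiemannSum_le p (fun z ↦ (h _ ?_ z).le) N
        rw [abs_of_nonneg (by positivity)]
        have hr' : (r : ℝ) ≤ M := by exact_mod_cast (Finset.mem_range.1 hr).le
        have hKN : (K : ℝ) ≤ N := by norm_cast; omega
        calc 2 * Real.pi * r / (N * M) ≤ 2 * Real.pi * M / (N * M) := by gcongr
          _ = 2 * Real.pi / N := by field_simp
          _ < δ := by
            rw [div_lt_iff₀ hN1]
            rw [div_lt_iff₀ hδ] at hK
            nlinarith
      _ = _ := by simp
  refine ⟨K + 1, fun m hm n hn ↦ ?_⟩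
  have h1 := key m hm n hn
  have h2 := key n hn m hm
  rw [mul_comm n m] at h2
  rw [map_sub_rev] at h1
  calc _ = p ((circleRiemannSum F m - circleRiemannSum F (m * n)) +
        (circleRiemannSum F (m * n) - circleRiemannSum F n)) := by rw [sub_add_sub_cancel]
    _ ≤ _ := map_add_le_add p _ _
    _ < ε := by linarith

theorem tendsto_circleRiemannSum [UniformSpace X] [IsUniformAddGroup X] [CompleteSpace X]
    [PolynormableSpace ℂ X] {F : Circle → X} (hF : Continuous F) :
    Tendsto (circleRiemannSum F) atTop (𝓝 (circleMean F)) :=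
  tendsto_nhds_limUnder (cauchySeq_tendsto_of_complete (cauchySeq_circleRiemannSum hF))

variable [UniformSpace X] [IsUniformAddGroup X] [CompleteSpace X] [PolynormableSpace ℂ X]

theorem map_circleMean {Y : Type*} [AddCommGroup Y] [Module ℂ Y] [UniformSpace Y]
    [IsUniformAddGroup Y] [CompleteSpace Y] [PolynormableSpace ℂ Y] [T2Space Y] (φ : X →L[ℂ] Y)
    {F : Circle → X} (hF : Continuous F) :
    φ (circleMean F) = circleMean fun z ↦ φ (F z) := by
  refine tendsto_nhds_unique ((φ.continuous.tendsto _).comp (tendsto_circleRiemannSum hF)) ?_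
  simpa only [Function.comp_def, map_circleRiemannSum] using
    tendsto_circleRiemannSum (φ.continuous.comp hF)

theorem seminorm_circleMean_le {p : Seminorm ℂ X} (hp : Continuous p) {F : Circle → X}
    (hF : Continuous F) {C : ℝ} (h : ∀ z, p (F z) ≤ C) : p (circleMean F) ≤ C :=
  le_of_tendsto ((hp.tendsto _).comp (tendsto_circleRiemannSum hF))
    (Eventually.of_forall fun N ↦ seminorm_circleRiemannSum_le p h N)

variable [T2Space X]

theorem circleMean_sub {F G : Circle → X} (hF : Continuous F) (hG : Continuous G) :
    circleMean (fun z ↦ F z - G z) = circleMean F - circleMean G := by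
  refine tendsto_nhds_unique (tendsto_circleRiemannSum (hF.sub hG)) ?_
  exact ((tendsto_circleRiemannSum hF).sub (tendsto_circleRiemannSum hG)).congr fun N ↦
    (circleRiemannSum_sub F G N).symm

theorem circleMean_smul (c : ℂ) {F : Circle → X} (hF : Continuous F) :
    circleMean (fun z ↦ c • F z) = c • circleMean F := by
  have := (PolynormableSpace.withSeminorms ℂ X).continuousSMul
  exact (map_circleMean (c • ContinuousLinearMap.id ℂ X) hF).symm

/-- Rotation by `2π / K` permutes the `N`-th roots of unity when `K` divides `N`, so the Riemann
sums agree along the multiples of `K`. Such rotations suffice for the half-period argument below. -/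
theorem circleMean_rotate {F : Circle → X} (hF : Continuous F) {K : ℕ} (hK : 0 < K) :
    circleMean (fun z ↦ F (Circle.exp (2 * Real.pi / K) * z)) = circleMean F := by
  have hG : Continuous fun z ↦ F (Circle.exp (2 * Real.pi / K) * z) := by fun_prop
  have hl : Tendsto (fun M : ℕ ↦ K * (M + 1)) atTop atTop :=
    (tendsto_add_atTop_nat 1).const_mul_atTop' hK
  refine tendsto_nhds_unique ((tendsto_circleRiemannSum hG).comp hl) ?_
  refine ((tendsto_circleRiemannSum hF).comp hl).congr fun M ↦ ?_
  rw [Function.comp_apply, Function.comp_apply, ← circleRiemannSum_rotate F _ (M + 1)]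
  congr! 4
  push_cast
  field_simp

end Topology

end CircleMean

/-! ### Moments of functions on the circle: density and decay -/

section CircleMoment

/-- Needed only for scalar functions, to identify moments with Fourier coefficients. -/
theorem circleMean_eq_intervalIntegral {G : Circle → ℂ} (hG : Continuous G) :
    circleMean G = (2 * Real.pi : ℂ)⁻¹ * ∫ t in (0 : ℝ)..2 * Real.pi, G (Circle.exp t) := by
  refine tendsto_nhds_unique (tendsto_circleRiemannSum hG) ?_
  rw [Metric.tendsto_atTop]
  intro ε hε
  obtain ⟨δ, hδ, h⟩ := hG.exists_forall_seminorm_rotate_sub_lt (p := normSeminorm ℂ ℂ)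
    continuous_norm (half_pos hε)
  obtain ⟨K, hK⟩ := exists_nat_gt (2 * Real.pi / δ)
  refine ⟨K + 1, fun N hN ↦ ?_⟩
  have hpi := Real.pi_pos
  have hN1 : (0 : ℝ) < N := by norm_cast; omega
  have hKN : (K : ℝ) ≤ N := by norm_cast; omega
  have hstep : 2 * Real.pi / N < δ := by
    rw [div_lt_iff₀ hN1]
    rw [div_lt_iff₀ hδ] at hK
    nlinarith
  let a : ℕ → ℝ := fun m ↦ 2 * Real.pi * m / N
  have ha : ∀ m, a (m + 1) - a m = 2 * Real.pi / N := fun m ↦ by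
    simp only [a]; push_cast; ring
  have hc : Continuous fun t : ℝ ↦ G (Circle.exp t) := by fun_prop
  have hsum : ∫ t in (0 : ℝ)..2 * Real.pi, G (Circle.exp t) =
      ∑ m ∈ Finset.range N, ∫ t in a m..a (m + 1), G (Circle.exp t) := by
    rw [intervalIntegral.sum_integral_adjacent_intervals fun _ _ ↦ hc.intervalIntegrable _ _]
    simp [a, hN1.ne']
  have hdiff : circleRiemannSum G N -
      (2 * Real.pi : ℂ)⁻¹ * ∫ t in (0 : ℝ)..2 * Real.pi, G (Circle.exp t) =
      (2 * Real.pi : ℂ)⁻¹ * ∑ m ∈ Finset.range N,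
        ∫ t in a m..a (m + 1), (G (Circle.exp (a m)) - G (Circle.exp t)) := by
    rw [hsum, circleRiemannSum, smul_eq_mul, Finset.mul_sum, Finset.mul_sum, Finset.mul_sum,
      ← Finset.sum_sub_distrib]
    refine Finset.sum_congr rfl fun m _ ↦ ?_
    rw [intervalIntegral.integral_sub (by simp) (hc.intervalIntegrable _ _),
      intervalIntegral.integral_const, ha, mul_sub, Complex.real_smul]
    congr 1
    have hN2 : (N : ℂ) ≠ 0 := by exact_mod_cast hN1.ne'
    have hpi2 : (Real.pi : ℂ) ≠ 0 := by exact_mod_cast hpi.ne'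
    push_cast
    field_simp
    rfl
  rw [dist_eq_norm, hdiff, norm_mul, norm_inv]
  have hn : ‖(2 * Real.pi : ℂ)‖ = 2 * Real.pi := by simp [abs_of_pos hpi]
  rw [hn, inv_mul_lt_iff₀ (by positivity)]
  calc _ ≤ ∑ m ∈ Finset.range N, ε / 2 * |a (m + 1) - a m| := by
        refine (norm_sum_le _ _).trans (Finset.sum_le_sum fun m _ ↦ ?_)
        refine intervalIntegral.norm_integral_le_of_norm_le_const fun t ht ↦ ?_
        rw [Set.uIoc_of_le (by linarith [ha m, show 0 ≤ 2 * Real.pi / N by positivity])] at ht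
        have := h (t - a m) (by
          rw [abs_of_nonneg (by linarith [ht.1])]
          linarith [ht.2, ha m]) (Circle.exp (a m))
        rw [← Circle.exp_add, sub_add_cancel, map_sub_rev] at this
        exact this.le
    _ = ε / 2 * (2 * Real.pi) := by
        simp only [ha, abs_of_pos (show 0 < 2 * Real.pi / N by positivity), Finset.sum_const,
          Finset.card_range, nsmul_eq_mul]
        field_simp
    _ < 2 * Real.pi * ε := by nlinarith

theorem Continuous.circle_zpow_smul {X : Type*} [AddCommGroup X] [Module ℂ X] [TopologicalSpace X]
    [ContinuousSMul ℂ X] {E : Circle → X} (hE : Continuous E) (i : ℤ) :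
    Continuous fun z : Circle ↦ (z : ℂ) ^ i • E z :=
  have h : Continuous fun z : Circle ↦ (z : ℂ) := continuous_subtype_val
  (h.zpow₀ i fun z ↦ Or.inl z.coe_ne_zero).smul hE

/-- The moments `∫ zⁱ E(z) dz` (with respect to normalized arc length) of a function on the
circle. -/
noncomputable def circleMoment {X : Type*} [AddCommGroup X] [Module ℂ X] [TopologicalSpace X]
    (E : Circle → X) (i : ℤ) : X :=
  circleMean fun z ↦ (z : ℂ) ^ i • E z

/-- A continuous scalar function on the circle with vanishing moments is zero. -/
theorem eq_zero_of_circleMoment_eq_zero {G : Circle → ℂ} (hG : Continuous G)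
    (h : ∀ i, circleMoment G i = 0) (z : Circle) : G z = 0 := by
  have : Fact (0 < 2 * Real.pi) := ⟨Real.two_pi_pos⟩
  let f : C(AddCircle (2 * Real.pi), ℂ) :=
    ⟨fun x ↦ G (AddCircle.toCircle x), hG.comp AddCircle.continuous_toCircle⟩
  have hexp (t : ℝ) : AddCircle.toCircle (t : AddCircle (2 * Real.pi)) = Circle.exp t := by
    rw [AddCircle.toCircle_apply_mk, div_self Real.two_pi_pos.ne', one_mul]
  have hf (n : ℤ) : fourierCoeff f n = 0 := by
    have hn := h (-n)
    rw [circleMoment, circleMean_eq_intervalIntegral (hG.circle_zpow_smul _), mul_eq_zero] at hn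
    rw [fourierCoeff_eq_intervalIntegral f n 0, zero_add]
    have : ∀ t : ℝ, (fourier (-n) (t : AddCircle (2 * Real.pi)) : ℂ) • f t =
        (Circle.exp t : ℂ) ^ (-n) • G (Circle.exp t) := fun t ↦ by
      rw [fourier_apply, AddCircle.toCircle_zsmul, hexp, Circle.coe_zpow, ← hexp]
      rfl
    simp only [this]
    rw [hn.resolve_left (by simp [Real.pi_ne_zero]), smul_zero]
  -- Vanishing coefficients are summable, so the Fourier series converges pointwise to `f`; its sum
  -- is zero.
  have hs := has_pointwise_sum_fourier_series_of_summable (f := f)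
    (by simp [funext hf]) (Complex.arg z : ℝ)
  simp only [hf, zero_smul] at hs
  have := hs.unique hasSum_zero
  simpa [f, hexp, Circle.exp_arg] using this

variable {X : Type*} [AddCommGroup X] [Module ℂ X] [UniformSpace X] [IsUniformAddGroup X]
  [ContinuousSMul ℂ X] [PolynormableSpace ℂ X]

theorem norm_circle_zpow (z : Circle) (i : ℤ) : ‖(z : ℂ) ^ i‖ = 1 := by
  rw [norm_zpow, Circle.norm_coe, one_zpow]

variable [CompleteSpace X]

theorem seminorm_circleMoment_le {E : Circle → X} (hE : Continuous E) {p : Seminorm ℂ X}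
    (hp : Continuous p) (i : ℤ) {C : ℝ} (h : ∀ z, p (E z) ≤ C) : p (circleMoment E i) ≤ C :=
  seminorm_circleMean_le hp (hE.circle_zpow_smul i) fun z ↦ by
    rw [map_smul_eq_mul, norm_circle_zpow, one_mul]
    exact h z

theorem map_circleMoment {Y : Type*} [AddCommGroup Y] [Module ℂ Y] [UniformSpace Y]
    [IsUniformAddGroup Y] [CompleteSpace Y] [PolynormableSpace ℂ Y] [T2Space Y] (φ : X →L[ℂ] Y)
    {E : Circle → X} (hE : Continuous E) (i : ℤ) :
    φ (circleMoment E i) = circleMoment (fun z ↦ φ (E z)) i := by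
  rw [circleMoment, map_circleMean φ (hE.circle_zpow_smul i)]
  simp [circleMoment]

/-- The moments of a family of continuous functions span a dense subspace whenever the values of
these functions do. -/
theorem dense_span_circleMoment {J : Type*} {E : J → Circle → X} (hE : ∀ j, Continuous (E j))
    (hd : Dense (Submodule.span ℂ {x : X | ∃ (j : J) (z : Circle), E j z = x} : Set X)) :
    Dense (Submodule.span ℂ {x : X | ∃ (j : J) (i : ℤ), circleMoment (E j) i = x} : Set X) := by
  refine Submodule.dense_of_forall_strongDual_eq_zero _ fun φ hφ ↦ ?_
  have h0 (j : J) (z : Circle) : φ (E j z) = 0 :=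
    eq_zero_of_circleMoment_eq_zero (φ.continuous.comp (hE j)) (fun i ↦ by
      rw [← hφ _ (Submodule.subset_span ⟨j, i, rfl⟩), map_circleMoment φ (hE j)]
      rfl) z
  refine ContinuousLinearMap.ext_on hd ?_
  rintro _ ⟨j, z, rfl⟩
  simpa using h0 j z

variable [T2Space X]

/-- On the moments of a field of eigenvectors the operator acts as a shift. -/
theorem map_circleMoment_of_eigen (S : X →L[ℂ] X) {E : Circle → X} (hE : Continuous E)
    (hS : ∀ z, S (E z) = (z : ℂ) • E z) (i : ℤ) :
    S (circleMoment E i) = circleMoment E (i + 1) := by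
  rw [map_circleMoment S hE, circleMoment, circleMoment]
  congr 1
  ext z
  rw [hS, smul_smul, zpow_add₀ z.coe_ne_zero, zpow_one]

/-- The rotation by half a period of `z ↦ zⁱ`. -/
noncomputable def halfRotation (i : ℤ) : Circle := Circle.exp (2 * Real.pi / (2 * i.natAbs : ℕ))

theorem halfRotation_zpow {i : ℤ} (hi : i ≠ 0) : ((halfRotation i : Circle) : ℂ) ^ i = -1 := by
  have hn : (halfRotation i : ℂ) ^ i.natAbs = -1 := by
    rw [halfRotation, Circle.coe_exp, ← Complex.exp_nat_mul]
    have : (i.natAbs : ℂ) ≠ 0 := by simpa using hi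
    rw [← Complex.exp_pi_mul_I]
    congr 1
    push_cast
    field_simp
  generalize halfRotation i = w at hn
  rcases Int.natAbs_eq i with h | h <;> rw [h]
  · rw [zpow_natCast, hn]
  · rw [zpow_neg, zpow_natCast, hn]
    norm_num

theorem circleMoment_sub {E F : Circle → X} (hE : Continuous E) (hF : Continuous F) (i : ℤ) :
    circleMoment (fun z ↦ E z - F z) i = circleMoment E i - circleMoment F i := by
  simp only [circleMoment, smul_sub]
  exact circleMean_sub (hE.circle_zpow_smul i) (hF.circle_zpow_smul i)

theorem circleMoment_halfRotation {E : Circle → X} (hE : Continuous E) {i : ℤ} (hi : i ≠ 0) :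
    circleMoment (fun z ↦ E (halfRotation i * z)) i = -circleMoment E i := by
  -- The angle of `halfRotation i` is `2π / K` with `K = 2|i|`, as rotation invariance of the mean
  -- requires.
  have h := circleMean_rotate (hE.circle_zpow_smul i) (K := 2 * i.natAbs) (by positivity)
  have h2 := circleMean_smul (-1) (F := fun z ↦ (z : ℂ) ^ i • E (halfRotation i * z))
    ((hE.comp (continuous_const.mul continuous_id)).circle_zpow_smul i)
  rw [circleMoment, circleMoment, ← h, ← neg_eq_iff_eq_neg, ← neg_one_smul ℂ, ← h2]
  congr 1
  ext z
  rw [← halfRotation, Circle.coe_mul, mul_zpow, halfRotation_zpow hi, smul_smul]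

/-- Half a period of rotation changes the sign of the moment, so the difference of the rotated and
the original function has moment `-2` times that of `E`. -/
theorem seminorm_circleMoment_le_first_difference {E : Circle → X} (hE : Continuous E)
    {p : Seminorm ℂ X} (hp : Continuous p) {i : ℤ} (hi : i ≠ 0) {C : ℝ}
    (h : ∀ z, p (E (halfRotation i * z) - E z) ≤ C) : p (circleMoment E i) ≤ C / 2 := by
  have hE' : Continuous fun z ↦ E (halfRotation i * z) := by fun_prop
  have h2 := seminorm_circleMoment_le (hE'.sub hE) hp i h
  have h1 : circleMoment ((fun z ↦ E (halfRotation i * z)) - E) i = (-2 : ℂ) • circleMoment E i :=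
    (circleMoment_sub hE' hE i).trans <| by
      rw [circleMoment_halfRotation hE hi]
      module
  rw [h1, map_smul_eq_mul] at h2
  norm_num at h2
  linarith

/-- The first-difference bound is applied to `E - E(w⁻¹ ·)`, with `w` the half rotation; its moment
is twice that of `E`. -/
theorem seminorm_circleMoment_le_second_difference {E : Circle → X} (hE : Continuous E)
    {p : Seminorm ℂ X} (hp : Continuous p) {i : ℤ} (hi : i ≠ 0) {C : ℝ}
    (h : ∀ z, p (E (halfRotation i * z) - E z - (E z - E ((halfRotation i)⁻¹ * z))) ≤ C) :
    p (circleMoment E i) ≤ C / 4 := by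
  have hE' : Continuous fun z ↦ E ((halfRotation i)⁻¹ * z) := by fun_prop
  have h2 := seminorm_circleMoment_le_first_difference (hE.sub hE') hp hi (C := C) (by simpa using h)
  have h3 := circleMoment_halfRotation hE' hi
  simp only [inv_mul_cancel_left] at h3
  have h1 : circleMoment (E - fun z ↦ E ((halfRotation i)⁻¹ * z)) i = (2 : ℂ) • circleMoment E i :=
    (circleMoment_sub hE hE' i).trans <| by
      rw [← neg_neg (circleMoment (fun z ↦ E ((halfRotation i)⁻¹ * z)) i), ← h3]
      module
  rw [h1, map_smul_eq_mul] at h2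
  norm_num at h2
  linarith

/-- Riemann–Lebesgue: the half rotation has angle `π / |i| → 0`, so uniform continuity makes the
first difference small. -/
theorem tendsto_circleMoment_cofinite {E : Circle → X} (hE : Continuous E) :
    Tendsto (circleMoment E) cofinite (𝓝 0) := by
  rw [PolynormableSpace.tendsto_nhds]
  intro p hp ε hε
  obtain ⟨δ, hδ, h⟩ := hE.exists_forall_seminorm_rotate_sub_lt hp hε
  obtain ⟨K, hK⟩ := exists_nat_gt (2 * Real.pi / δ)
  filter_upwards [(Set.finite_Icc (-(K : ℤ)) K).compl_mem_cofinite] with i hi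
  have hiK : K < i.natAbs := by
    simp only [Set.mem_compl_iff, Set.mem_Icc, not_and_or, not_le] at hi
    omega
  have hiK' : (K : ℝ) < i.natAbs := by exact_mod_cast hiK
  have hi0 : i ≠ 0 := by rintro rfl; simp at hiK
  have := seminorm_circleMoment_le_first_difference hE hp hi0 (C := ε) fun z ↦ by
    refine (h _ ?_ z).le
    rw [abs_of_nonneg (by positivity)]
    have hn : (0 : ℝ) < i.natAbs := (Nat.cast_nonneg K).trans_lt hiK'
    rw [div_lt_iff₀ (by positivity)]
    rw [div_lt_iff₀ hδ] at hK
    push_cast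
    nlinarith [Real.pi_pos]
  rw [sub_zero]
  linarith

end CircleMoment

/-! ### Quadratic decay of the moments of `C²` functions -/

section CircleC2

variable {X : Type*} [AddCommGroup X] [Module ℂ X]

theorem HasCurveDeriv.map [TopologicalSpace X] {Y : Type*} [AddCommGroup Y] [Module ℂ Y]
    [TopologicalSpace Y] {f f' : ℝ → X} (h : HasCurveDeriv f f') (φ : X →L[ℂ] Y) :
    HasCurveDeriv (fun t ↦ φ (f t)) (fun t ↦ φ (f' t)) := by
  intro t
  refine ((φ.continuous.tendsto _).comp (h t)).congr fun u ↦ ?_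
  simp only [Function.comp_apply, slope, vsub_eq_sub, ← map_sub]
  exact φ.map_smul_of_tower _ _

theorem HasCurveDeriv.hasDerivAt [TopologicalSpace X] {f f' : ℝ → X} (h : HasCurveDeriv f f')
    (φ : StrongDual ℂ X) (t : ℝ) : HasDerivAt (fun t ↦ φ (f t)) (φ (f' t)) t :=
  hasDerivAt_iff_tendsto_slope.2 (h.map φ t)

theorem IsCircleC2.map [TopologicalSpace X] {Y : Type*} [AddCommGroup Y] [Module ℂ Y]
    [TopologicalSpace Y] {E : Circle → X} (h : IsCircleC2 E) (φ : X →L[ℂ] Y) :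
    IsCircleC2 fun z ↦ φ (E z) := by
  obtain ⟨f', f'', h1, h2, h3⟩ := h
  exact ⟨_, _, h1.map φ, h2.map φ, φ.continuous.comp h3⟩

theorem HasCurveDeriv.continuous [TopologicalSpace X] [IsTopologicalAddGroup X]
    [ContinuousSMul ℂ X] {f f' : ℝ → X} (h : HasCurveDeriv f f') : Continuous f := by
  have : ContinuousSMul ℝ X := IsScalarTower.continuousSMul (M := ℝ) (α := X) ℂ
  rw [continuous_iff_continuousAt]
  intro t
  rw [continuousAt_iff_punctured_nhds]
  have h1 : Tendsto (fun u : ℝ ↦ u - t) (𝓝[≠] t) (𝓝 (t - t)) :=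
    ((continuous_id.sub continuous_const).tendsto t).mono_left nhdsWithin_le_nhds
  have h2 := (h1.smul (h t)).add_const (f t)
  rw [sub_self, zero_smul, zero_add] at h2
  refine h2.congr fun u ↦ ?_
  rw [sub_smul_slope, vsub_eq_sub, sub_add_cancel]

theorem IsCircleC2.continuous [TopologicalSpace X] [IsTopologicalAddGroup X]
    [ContinuousSMul ℂ X] {E : Circle → X} (h : IsCircleC2 E) : Continuous E := by
  obtain ⟨f', f'', h1, -, -⟩ := h
  exact Circle.isAddQuotientCoveringMap_exp.toIsQuotientMap.continuous_iff.2 h1.continuous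

/-- The second difference of a `C²` curve is bounded by the square of the step width. -/
theorem HasCurveDeriv.seminorm_second_difference_le [TopologicalSpace X] [PolynormableSpace ℂ X]
    {f f' f'' : ℝ → X} (h1 : HasCurveDeriv f f') (h2 : HasCurveDeriv f' f'') {p : Seminorm ℂ X}
    (hp : Continuous p) {t d C : ℝ} (hd : 0 ≤ d)
    (hC : ∀ s ∈ Set.Icc (t - d) (t + d), p (f'' s) ≤ C) :
    p (f (t + d) - f t - (f t - f (t - d))) ≤ C * d ^ 2 := by
  -- A functional norming the second difference reduces the claim to scalar functions, where the
  -- mean value inequality is used twice: for `f'` and for `s ↦ f (s + d) - f s`.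
  obtain ⟨φ, hφ, hw⟩ := Seminorm.exists_strongDual_eq hp (f (t + d) - f t - (f t - f (t - d)))
  have hf' : ∀ s ∈ Set.Icc (t - d) t, ‖φ (f' (s + d)) - φ (f' s)‖ ≤ C * d := by
    intro s hs
    have := (convex_Icc s (s + d)).norm_image_sub_le_of_norm_hasDerivWithin_le
      (f := fun s ↦ φ (f' s)) (f' := fun s ↦ φ (f'' s)) (C := C)
      (fun x _ ↦ (h2.hasDerivAt φ x).hasDerivWithinAt)
      (fun x hx ↦ (hφ _).trans (hC x ⟨hs.1.trans hx.1, hx.2.trans (by linarith [hs.2])⟩))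
      (Set.left_mem_Icc.2 (by linarith)) (Set.right_mem_Icc.2 (by linarith))
    simpa [abs_of_nonneg hd] using this
  have := (convex_Icc (t - d) t).norm_image_sub_le_of_norm_hasDerivWithin_le
    (f := fun s ↦ φ (f (s + d)) - φ (f s)) (f' := fun s ↦ φ (f' (s + d)) - φ (f' s)) (C := C * d)
    (fun x _ ↦ (((h1.hasDerivAt φ (x + d)).comp_add_const x d).sub
      (h1.hasDerivAt φ x)).hasDerivWithinAt) hf'
    (Set.left_mem_Icc.2 (by linarith)) (Set.right_mem_Icc.2 (by linarith))
  rw [sub_add_cancel, sub_sub_cancel, Real.norm_of_nonneg hd, ← map_sub, ← map_sub, ← map_sub,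
    hw, Complex.norm_real, Real.norm_of_nonneg (apply_nonneg p _)] at this
  linarith

theorem IsCircleC2.summable_circleMoment [UniformSpace X] [IsUniformAddGroup X]
    [ContinuousSMul ℂ X] [PolynormableSpace ℂ X] [CompleteSpace X] [T2Space X] {E : Circle → X}
    (h : IsCircleC2 E) {p : Seminorm ℂ X} (hp : Continuous p) :
    Summable fun i : ℤ ↦ p (circleMoment E i) := by
  have hE := h.continuous
  obtain ⟨f', f'', h1, h2, h3⟩ := h
  -- The argument of `z` lies in `(-π, π]` and the step `π / |i|` is at most `π`, so this interval
  -- contains every parameter that occurs.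
  obtain ⟨C, hC⟩ := (isCompact_Icc (a := -(2 * Real.pi)) (b := 2 * Real.pi)).bddAbove_image
    (hp.comp h3).continuousOn
  have hC' : ∀ s ∈ Set.Icc (-(2 * Real.pi)) (2 * Real.pi), p (f'' s) ≤ C := fun s hs ↦
    hC (Set.mem_image_of_mem _ hs)
  have hs : Summable fun i : ℤ ↦ C * Real.pi ^ 2 / 4 * (1 / (i : ℝ) ^ 2) :=
    (Real.summable_one_div_int_pow.2 one_lt_two).mul_left _
  refine hs.of_norm_bounded_eventually ?_
  filter_upwards [(Set.finite_singleton (0 : ℤ)).compl_mem_cofinite] with i hi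
  have hi0 : i ≠ 0 := hi
  have hi1 : (1 : ℝ) ≤ i.natAbs := by exact_mod_cast Int.natAbs_pos.2 hi0
  have hrot : halfRotation i = Circle.exp (Real.pi / i.natAbs) := by
    rw [halfRotation]
    congr 1
    push_cast
    field_simp
  have hd1 : Real.pi / i.natAbs ≤ Real.pi := div_le_self Real.pi_pos.le hi1
  rw [Real.norm_of_nonneg (apply_nonneg p _)]
  refine (seminorm_circleMoment_le_second_difference hE hp hi0
    (C := C * (Real.pi / i.natAbs) ^ 2) fun z ↦ ?_).trans_eq ?_
  · have := h1.seminorm_second_difference_le h2 hp (t := Complex.arg z) (d := Real.pi / i.natAbs)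
      (C := C) (by positivity) fun s hs ↦ hC' s ⟨?_, ?_⟩
    · simpa only [hrot, sub_eq_add_neg, Circle.exp_add, Circle.exp_neg,
        Circle.exp_arg, mul_comm] using this
    · linarith [hs.1, Complex.neg_pi_lt_arg z]
    · linarith [hs.2, Complex.arg_le_pi z]
  · rw [div_pow, Nat.cast_natAbs, Int.cast_abs, sq_abs]
    ring

end CircleC2

/-! ### Separated sets of positive lower density -/

section SeparatedSets

/-- `v₂(i!) + v₂((i-1)!)`, written for `i = j + 1`: the positions of a sequence in which the gap
between the `i`-th and the `i'`-th term is at least `v₂(i) + v₂(i')`. -/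
def rulerPosition (j : ℕ) : ℕ :=
  padicValNat 2 (j + 1).factorial + padicValNat 2 j.factorial

theorem padicValNat_two_factorial_succ (j : ℕ) : padicValNat 2 (j + 1).factorial =
    padicValNat 2 (j + 1) + padicValNat 2 j.factorial := by
  rw [Nat.factorial_succ, padicValNat.mul (by omega) (Nat.factorial_ne_zero j)]

theorem padicValNat_two_factorial_mono : Monotone fun j : ℕ ↦ padicValNat 2 j.factorial :=
  monotone_nat_of_le_succ fun j ↦ by rw [padicValNat_two_factorial_succ]; omega

/-- By Legendre's formula. The resulting linear growth of `rulerPosition` yields positive density.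
-/
theorem padicValNat_two_factorial_le (j : ℕ) : padicValNat 2 j.factorial ≤ j := by
  have := sub_one_mul_padicValNat_factorial (p := 2) j
  omega

theorem rulerPosition_le (j : ℕ) : rulerPosition j ≤ 2 * j + 1 := by
  have := padicValNat_two_factorial_le j
  have := padicValNat_two_factorial_le (j + 1)
  rw [rulerPosition]
  omega

theorem padicValNat_le_rulerPosition (j : ℕ) : padicValNat 2 (j + 1) ≤ rulerPosition j := by
  rw [rulerPosition, padicValNat_two_factorial_succ]
  omega

/-- The difference of the positions is the sum of `v₂(i)` over `j + 1 < i ≤ k + 1` plus that over `j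
< i ≤ k`. The first sum contains `v₂(k + 1)`, the second `v₂(j + 1)`. -/
theorem rulerPosition_add_le {j k : ℕ} (h : j < k) :
    rulerPosition j + padicValNat 2 (j + 1) + padicValNat 2 (k + 1) ≤ rulerPosition k := by
  have h1 := padicValNat_two_factorial_mono (show j + 1 ≤ k from h)
  have h2 := padicValNat_two_factorial_succ j
  have h3 := padicValNat_two_factorial_succ k
  simp only [rulerPosition] at *
  omega

theorem ncard_inter_Icc_div_le_one (A : Set ℕ) (n : ℕ) :
    ((A ∩ Set.Icc 1 n).ncard : ℝ) / n ≤ 1 := by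
  have : (A ∩ Set.Icc 1 n).ncard ≤ n := by
    refine (Set.ncard_le_ncard Set.inter_subset_right (Set.finite_Icc 1 n)).trans ?_
    simp
  exact div_le_one_of_le₀ (by exact_mod_cast this) (Nat.cast_nonneg n)

theorem isCoboundedUnder_ge_ncard_inter_Icc_div (A : Set ℕ) :
    IsCoboundedUnder (· ≥ ·) atTop fun n : ℕ ↦ ((A ∩ Set.Icc 1 n).ncard : ℝ) / n :=
  (isBoundedUnder_of ⟨1, ncard_inter_Icc_div_le_one A⟩).isCoboundedUnder_ge

theorem le_natLowerDensity {A : Set ℕ} {c : ℝ}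
    (h : ∀ᶠ n : ℕ in atTop, c ≤ ((A ∩ Set.Icc 1 n).ncard : ℝ) / n) : c ≤ natLowerDensity A :=
  le_liminf_of_le (isCoboundedUnder_ge_ncard_inter_Icc_div A) h

theorem natLowerDensity_mono {A B : Set ℕ} (h : A ⊆ B) :
    natLowerDensity A ≤ natLowerDensity B := by
  refine liminf_le_liminf (Eventually.of_forall fun n ↦ ?_)
    (isBoundedUnder_of ⟨0, fun n ↦ by positivity⟩) (isCoboundedUnder_ge_ncard_inter_Icc_div B)
  have := Set.ncard_le_ncard (Set.inter_subset_inter_left (Set.Icc 1 n) h)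
    ((Set.finite_Icc 1 n).inter_of_right B)
  gcongr

/-- An enumeration growing at most like `a t + b` leaves about `n / a` elements below `n`; the bound
`1 / (2a)` absorbs the additive errors for large `n`. -/
theorem natLowerDensity_pos_of_strictMono {A : Set ℕ} {f : ℕ → ℕ} (hf : StrictMono f)
    (hA : ∀ t, f t ∈ A) {a b : ℕ} (ha : 0 < a) (hab : ∀ t, f t ≤ a * t + b) :
    0 < natLowerDensity A := by
  have ha' : (0 : ℝ) < a := by exact_mod_cast ha
  refine (show (0 : ℝ) < 1 / (2 * a) by positivity).trans_le (le_natLowerDensity ?_)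
  filter_upwards [eventually_ge_atTop (2 * (2 * a + b))] with n hn
  -- indices `t` from `1` to `(n - b) / a` give elements of `A` in `[1, n]`
  have hcard : (n - b) / a ≤ (A ∩ Set.Icc 1 n).ncard := by
    have hsub : (Finset.Icc 1 ((n - b) / a)).image f ⊆
        ((Set.finite_Icc 1 n).inter_of_right A).toFinset := by
      intro m hm
      obtain ⟨t, ht, rfl⟩ := Finset.mem_image.1 hm
      rw [Finset.mem_Icc] at ht
      have h1 : t * a ≤ n - b := (Nat.le_div_iff_mul_le ha).1 ht.2
      have h2 := hab t
      have h3 := hf.le_apply (x := t)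
      rw [mul_comm] at h2
      simp only [Set.Finite.mem_toFinset, Set.mem_inter_iff, hA, Set.mem_Icc, true_and]
      omega
    have := Finset.card_le_card hsub
    rw [Finset.card_image_of_injective _ hf.injective, Nat.card_Icc] at this
    rw [Set.ncard_eq_toFinset_card _ ((Set.finite_Icc 1 n).inter_of_right A)]
    simpa using this
  have hlt : n - b < ((n - b) / a + 1) * a := by
    have := Nat.lt_div_mul_add (a := n - b) ha
    rw [add_mul, one_mul]
    exact this
  have hn0 : (0 : ℝ) < n := by exact_mod_cast (by omega : 0 < n)
  rw [le_div_iff₀ hn0, div_mul_eq_mul_div, one_mul, div_le_iff₀ (by positivity)]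
  have h1 : n < ((A ∩ Set.Icc 1 n).ncard + 1) * a + b := by
    have : ((n - b) / a + 1) * a ≤ ((A ∩ Set.Icc 1 n).ncard + 1) * a := by gcongr
    omega
  have h2 : (n : ℝ) < ((A ∩ Set.Icc 1 n).ncard + 1) * a + b := by exact_mod_cast h1
  have h3 : (2 * (2 * a + b) : ℝ) ≤ n := by exact_mod_cast hn
  nlinarith

/-- For given widths `N l` there are pairwise disjoint sets `A l` of positive lower density, bounded
below by `N l`, such that different elements of `A l` and `A k` are at a distance of at least
`N l + N k`. -/
theorem exists_separated_sets (N : ℕ → ℕ) : ∃ A : ℕ → Set ℕ,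
    (∀ l, 0 < natLowerDensity (A l)) ∧ (∀ l, ∀ n ∈ A l, N l ≤ n) ∧
    (∀ l k, ∀ n ∈ A l, ∀ m ∈ A k, (l, n) ≠ (k, m) → N l + N k ≤ ((n : ℤ) - m).natAbs ∧ n ≠ m) := by
  -- `A l` collects the positions of indices with valuation `e l`. Strict monotonicity of `e`
  -- separates the classes, and `e l > N l` gives the required gaps.
  let e : ℕ → ℕ := fun l ↦ 1 + ∑ k ∈ Finset.range (l + 1), (N k + 1)
  have he : StrictMono e := strictMono_nat_of_lt_succ fun l ↦ by
    simp only [e, Finset.sum_range_succ _ (l + 1)]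
    omega
  have heN (l) : N l + 1 ≤ e l := by
    simp only [e, Finset.sum_range_succ]
    omega
  refine ⟨fun l ↦ {n | ∃ j, padicValNat 2 (j + 1) = e l ∧ rulerPosition j = n}, fun l ↦ ?_, ?_, ?_⟩
  -- Valuation `e l` occurs exactly at the odd multiples of `2 ^ e l`; the `- 1` undoes the shift `i
  -- = j + 1`.
  · have hv (t : ℕ) : padicValNat 2 (2 ^ e l * (2 * t + 1) - 1 + 1) = e l := by
      rw [Nat.sub_add_cancel (Nat.mul_pos (by positivity) (by omega)),
        padicValNat.mul (by positivity) (by omega), padicValNat.prime_pow,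
        padicValNat.eq_zero_of_not_dvd (by omega), add_zero]
    refine natLowerDensity_pos_of_strictMono (f := fun t ↦ rulerPosition (2 ^ e l * (2 * t + 1) - 1))
      (a := 4 * 2 ^ e l) (b := 2 * 2 ^ e l) ?_ (fun t ↦ ⟨_, hv t, rfl⟩) (by positivity) fun t ↦ ?_
    · intro s t hst
      have hpos : 0 < 2 ^ e l := by positivity
      have := rulerPosition_add_le (j := 2 ^ e l * (2 * s + 1) - 1)
        (k := 2 ^ e l * (2 * t + 1) - 1) (by
          have : 2 ^ e l * (2 * s + 1) < 2 ^ e l * (2 * t + 1) := by gcongr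
          have : 0 < 2 ^ e l * (2 * s + 1) := Nat.mul_pos hpos (by omega)
          omega)
      rw [hv, hv] at this
      have := heN l
      simp only
      omega
    · refine (rulerPosition_le _).trans ?_
      have : 0 < 2 ^ e l * (2 * t + 1) := Nat.mul_pos (by positivity) (by omega)
      have : 4 * 2 ^ e l * t + 2 * 2 ^ e l = 2 * (2 ^ e l * (2 * t + 1)) := by ring
      omega
  · rintro l _ ⟨j, hj, rfl⟩
    have := padicValNat_le_rulerPosition j
    have := heN l
    omega
  · rintro l k _ ⟨i, hi, rfl⟩ _ ⟨j, hj, rfl⟩ hne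
    have h1 := heN l
    have h2 := heN k
    rcases lt_trichotomy i j with h | rfl | h
    · have := rulerPosition_add_le h
      omega
    · exact (hne (Prod.ext (he.injective (hi.symm.trans hj)) rfl)).elim
    · have := rulerPosition_add_le h
      omega

end SeparatedSets

/-! ### Bi-infinite orbits -/

section Orbits

variable {X : Type*} [AddCommGroup X] [Module ℂ X] [TopologicalSpace X]

/-- Bi-infinite orbits of an operator. -/
def IsBiorbit (S : X →L[ℂ] X) (v : ℤ → X) : Prop :=
  ∀ i, S (v i) = v (i + 1)

theorem IsBiorbit.pow_apply {S : X →L[ℂ] X} {v : ℤ → X} (h : IsBiorbit S v) (n : ℕ) (i : ℤ) :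
    (S ^ n) (v i) = v (i + n) := by
  induction n with
  | zero => simp
  | succ n ih =>
    rw [pow_succ', mul_apply_eq_comp, ih, h]
    push_cast
    ring_nf

theorem IsBiorbit.comp_add {S : X →L[ℂ] X} {v : ℤ → X} (h : IsBiorbit S v) (k : ℤ) :
    IsBiorbit S fun i ↦ v (i + k) := fun i ↦ by
  rw [h]
  ring_nf

end Orbits

/-! ### The frequent hypercyclicity criterion -/

section FrequentHypercyclicity

theorem Summable.exists_sum_natAbs_ge_le {f : ℤ → ℝ} (hf : Summable f) {ε : ℝ} (hε : 0 < ε) :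
    ∃ N : ℕ, ∀ G : Finset ℤ, (∀ i ∈ G, N ≤ i.natAbs) → ∑ i ∈ G, f i ≤ ε := by
  obtain ⟨s, hs⟩ := summable_iff_vanishing.1 hf _ (Metric.ball_mem_nhds 0 hε)
  refine ⟨s.sup Int.natAbs + 1, fun G hG ↦ ?_⟩
  have := hs G <| Finset.disjoint_left.2 fun i hi his ↦ by
    have := hG i hi
    have := Finset.le_sup (f := Int.natAbs) his
    omega
  rw [mem_ball_zero_iff, Real.norm_eq_abs] at this
  exact (le_abs_self _).trans this.le

theorem sum_le_tsum_of_sum_fiber_le {ι κ : Type*} {g : ι × κ → ℝ} (hg : ∀ a, 0 ≤ g a) {B : ι → ℝ}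
    (hB : Summable B) (h : ∀ k, ∀ F : Finset κ, ∑ m ∈ F, g (k, m) ≤ B k) (F : Finset (ι × κ)) :
    ∑ a ∈ F, g a ≤ ∑' k, B k := by
  classical
  calc ∑ a ∈ F, g a ≤ ∑ a ∈ F.image Prod.fst ×ˢ F.image Prod.snd, g a :=
        Finset.sum_le_sum_of_subset_of_nonneg Finset.subset_product fun a _ _ ↦ hg a
    _ = ∑ k ∈ F.image Prod.fst, ∑ m ∈ F.image Prod.snd, g (k, m) := Finset.sum_product ..
    _ ≤ ∑ k ∈ F.image Prod.fst, B k := Finset.sum_le_sum fun k _ ↦ h k _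
    _ ≤ ∑' k, B k := hB.sum_le_tsum _ fun k _ ↦ by simpa using h k ∅

variable {X : Type*} [AddCommGroup X] [Module ℂ X]

theorem sum_ite_seminorm_eq (q : Seminorm ℂ X) (v : ℤ → X) (n : ℕ) (P : ℕ → Prop)
    [DecidablePred P] (F : Finset ℕ) : ∑ m ∈ F, q (if P m then v (n - m) else 0) =
      ∑ i ∈ (F.filter P).image fun m : ℕ ↦ (n : ℤ) - m, q (v i) := by
  rw [Finset.sum_image fun a _ b _ hab ↦ by simpa using hab, Finset.sum_filter]
  exact Finset.sum_congr rfl fun m _ ↦ by split_ifs <;> simp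

variable [UniformSpace X] [IsUniformAddGroup X] [CompleteSpace X] [PolynormableSpace ℂ X]
  [FirstCountableTopology X]

/-- The frequent hypercyclicity criterion: an operator with absolutely summable bi-infinite orbits
through the points of a countable dense set is frequently hypercyclic. -/
theorem exists_frequentlyHypercyclic_of_biorbit (S : X →L[ℂ] X) {v : ℕ → ℤ → X}
    (hv : ∀ l, IsBiorbit S (v l)) (hd : DenseRange fun l ↦ v l 0)
    (hs : ∀ (p : Seminorm ℂ X), Continuous p → ∀ l, Summable fun i ↦ p (v l i)) :
    ∃ x : X, ∀ V : Set X, IsOpen V → V.Nonempty → 0 < natLowerDensity {n | (S ^ n) x ∈ V} := by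
  classical
  obtain ⟨q, hqc, hqm, hq⟩ := PolynormableSpace.exists_monotone_seminorm (X := X)
  -- every orbit is listed infinitely often
  let w : ℕ → ℤ → X := fun l ↦ v l.unpair.1
  have hw (l) : IsBiorbit S (w l) := hv _
  -- One width `N l` serves the first `l + 1` orbits simultaneously. For a pair `j, k`, the larger
  -- index then gives the tail bound, by monotonicity of `q`.
  have htail (l : ℕ) : ∃ N : ℕ, ∀ k ≤ l, ∀ G : Finset ℤ, (∀ i ∈ G, N ≤ i.natAbs) →
      ∑ i ∈ G, q l (w k i) ≤ (1 / 2) ^ l * (1 / 2) ^ k := by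
    choose N hN using fun k ↦ (hs (q l) (hqc l) (k : ℕ).unpair.1).exists_sum_natAbs_ge_le
      (show (0 : ℝ) < (1 / 2) ^ l * (1 / 2) ^ k by positivity)
    refine ⟨(Finset.range (l + 1)).sup N, fun k hk G hG ↦ hN k G fun i hi ↦ ?_⟩
    exact (Finset.le_sup (f := N) (Finset.mem_range_succ_iff.2 hk)).trans (hG i hi)
  choose N hN using htail
  have hN' (j k : ℕ) (G : Finset ℤ) (hG : ∀ i ∈ G, N j ≤ i.natAbs ∧ N k ≤ i.natAbs) :
      ∑ i ∈ G, q j (w k i) ≤ (1 / 2) ^ j * (1 / 2) ^ k := by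
    rcases le_total k j with h | h
    · exact hN j k h G fun i hi ↦ (hG i hi).1
    · calc ∑ i ∈ G, q j (w k i) ≤ ∑ i ∈ G, q k (w k i) := Finset.sum_le_sum fun i _ ↦ hqm h _
        _ ≤ (1 / 2) ^ k * (1 / 2) ^ k := hN k k le_rfl G fun i hi ↦ (hG i hi).2
        _ ≤ (1 / 2) ^ j * (1 / 2) ^ k := by
          gcongr ?_ * _
          exact pow_le_pow_of_le_one (by norm_num) (by norm_num) h
  obtain ⟨A, hA, hAN, hsep⟩ := exists_separated_sets N
  -- The vector sought is the sum of `w k (-m)` over all `k` and `m ∈ A k`, so that after `m` steps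
  -- the term `(k, m)` passes through `w k 0`.
  let f : ℕ × ℕ → X := fun a ↦ if a.2 ∈ A a.1 then w a.1 (0 - a.2) else 0
  have hgeom : Summable fun k : ℕ ↦ (1 / 2 : ℝ) ^ k := summable_geometric_two
  have hf : Summable f := by
    refine summable_of_summable_seminorm hq fun j ↦ ?_
    -- The tail bound covers `k ≥ j`, since every `m ∈ A k` is at least `N k`; each of the finitely
    -- many other orbits is bounded by its total sum.
    let B : ℕ → ℝ := fun k ↦ if j ≤ k then (1 / 2) ^ k else ∑' i, q j (w k i)
    have hB : Summable B := by
      refine hgeom.of_norm_bounded_eventually_nat ?_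
      filter_upwards [eventually_ge_atTop j] with k hk
      simp [B, hk]
    refine summable_of_sum_le (fun _ ↦ apply_nonneg _ _)
      (sum_le_tsum_of_sum_fiber_le (fun _ ↦ apply_nonneg _ _) hB fun k F ↦ ?_)
    have := sum_ite_seminorm_eq (q j) (w k) 0 (· ∈ A k) F
    rw [Nat.cast_zero] at this
    simp only [f]
    rw [this]
    by_cases hk : j ≤ k
    · simp only [B, hk, if_true]
      calc _ ≤ ∑ i ∈ (F.filter (· ∈ A k)).image fun m : ℕ ↦ (0 : ℤ) - m, q k (w k i) :=
            Finset.sum_le_sum fun i _ ↦ hqm hk _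
        _ ≤ (1 / 2) ^ k * (1 / 2) ^ k := hN k k le_rfl _ fun i hi ↦ by
            obtain ⟨m, hm, rfl⟩ := Finset.mem_image.1 hi
            have := hAN k m (Finset.mem_filter.1 hm).2
            omega
        _ ≤ (1 / 2) ^ k := mul_le_of_le_one_left (by positivity)
            (pow_le_one₀ (by norm_num) (by norm_num))
    · simp only [B, hk, if_false]
      exact (hs (q j) (hqc j) _).sum_le_tsum _ fun i _ ↦ apply_nonneg _ _
  refine ⟨∑' a, f a, fun V hV hVne ↦ ?_⟩
  have key (j n : ℕ) (hn : n ∈ A j) :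
      q j ((S ^ n) (∑' a, f a) - w j 0) ≤ (1 / 2) ^ j * 2 := by
    -- At a time `n ∈ A j` the term `(j, n)` contributes `w j 0`. All others sit at `n - m` with `|n
    -- - m| ≥ N j + N k`, deep in the tails.
    let u : ℕ × ℕ → X := fun a ↦
      if a.2 ∈ A a.1 ∧ (j, n) ≠ (a.1, a.2) then w a.1 (n - a.2) else 0
    have hu : HasSum u ((S ^ n) (∑' a, f a) - w j 0) := by
      convert! (hf.hasSum.mapL (S ^ n)).sub (hasSum_ite_eq (j, n) (w j 0)) using 2 with a
      obtain ⟨k, m⟩ := a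
      simp only [u, f, apply_ite (S ^ n), map_zero, (hw k).pow_apply]
      by_cases h : (j, n) = (k, m)
      · obtain ⟨rfl, rfl⟩ := Prod.mk.inj h
        simp [hn]
      · have h' : (k, m) ≠ (j, n) := fun h' ↦ h h'.symm
        simp only [ne_eq, h, h', not_false_eq_true, and_true, if_false, sub_zero]
        congr! 2
        ring
    refine le_of_tendsto ((hqc j).tendsto _ |>.comp hu) (Eventually.of_forall fun F ↦ ?_)
    refine (Finset.le_sum_of_subadditive (q j) (map_zero _).le (map_add_le_add _) F u).trans ?_
    have htsum : ∑' k : ℕ, (1 / 2 : ℝ) ^ j * (1 / 2) ^ k = (1 / 2) ^ j * 2 := by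
      rw [tsum_mul_left, tsum_geometric_two]
    rw [← htsum]
    refine sum_le_tsum_of_sum_fiber_le (fun _ ↦ apply_nonneg _ _) (hgeom.mul_left _) (fun k G ↦ ?_) F
    simp only [u]
    rw [sum_ite_seminorm_eq (q j) (w k) n (fun m ↦ m ∈ A k ∧ (j, n) ≠ (k, m)) G]
    refine hN' j k _ fun i hi ↦ ?_
    obtain ⟨m, hm, rfl⟩ := Finset.mem_image.1 hi
    obtain ⟨-, hm, hne⟩ := Finset.mem_filter.1 hm
    have := (hsep j k n hn m hm hne).1
    omega
  obtain ⟨l, hl⟩ := hd.exists_mem_open hV hVne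
  obtain ⟨n, r, hr, hnr⟩ := hq ((fun y ↦ v l 0 + y) ⁻¹' V)
    ((hV.preimage (continuous_const_add _)).mem_nhds (by simpa using hl))
  obtain ⟨M, hM⟩ := exists_pow_lt_of_lt_one (show 0 < r / 2 by positivity)
    (show (1 / 2 : ℝ) < 1 by norm_num)
  -- an index beyond `n` and `M` at which the orbit through `v l 0` is listed
  let j := Nat.pair l (max n M)
  have hj : max n M ≤ j := Nat.right_le_pair _ _
  have hwj : w j = v l := by simp [w, j]
  refine (hA j).trans_le ?_
  refine natLowerDensity_mono fun m hm ↦ ?_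
  have h1 := key j m hm
  rw [hwj] at h1
  have h2 := hnr ((S ^ m) (∑' a, f a) - v l 0) <| by
    refine (hqm ((le_max_left n M).trans hj) _).trans_lt (h1.trans_lt ?_)
    have : (1 / 2 : ℝ) ^ j ≤ (1 / 2) ^ M :=
      pow_le_pow_of_le_one (by norm_num) (by norm_num) ((le_max_right n M).trans hj)
    linarith
  simpa using h2

end FrequentHypercyclicity

/-! ### Dynamics of continuous operators with eigenvector fields -/

section EigenvectorFields

variable {X : Type*} [AddCommGroup X] [Module ℂ X]

/-- The space of bi-infinite orbits of an operator. -/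
def biorbitSubmodule [TopologicalSpace X] (S : X →L[ℂ] X) : Submodule ℂ (ℤ → X) where
  carrier := {v | IsBiorbit S v}
  zero_mem' := fun i ↦ map_zero S
  add_mem' := fun {u v} hu hv i ↦ by
    rw [Pi.add_apply, map_add, hu i, hv i, Pi.add_apply]
  smul_mem' := fun c v hv i ↦ by
    rw [Pi.smul_apply, map_smul, hv i, Pi.smul_apply]

/-- The space of null families indexed by `ℤ`. -/
def nullFamilySubmodule (X : Type*) [AddCommGroup X] [Module ℂ X] [TopologicalSpace X]
    [IsTopologicalAddGroup X] [ContinuousSMul ℂ X] : Submodule ℂ (ℤ → X) where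
  carrier := {v | Tendsto v cofinite (𝓝 0)}
  zero_mem' := tendsto_const_nhds
  add_mem' := fun {u v} hu hv ↦ by
    have h := Tendsto.add (hu : Tendsto u _ _) hv
    rwa [add_zero] at h
  smul_mem' := fun c v hv ↦ by
    have h := Tendsto.const_smul (hv : Tendsto v _ _) c
    rwa [smul_zero] at h

/-- The space of families indexed by `ℤ` which are absolutely summable for every continuous
seminorm. -/
def absSummableFamilySubmodule (X : Type*) [AddCommGroup X] [Module ℂ X] [TopologicalSpace X] :
    Submodule ℂ (ℤ → X) where
  carrier := {v | ∀ p : Seminorm ℂ X, Continuous p → Summable fun i ↦ p (v i)}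
  zero_mem' := fun p _ ↦ by simp
  add_mem' := fun {u v} hu hv p hp ↦ ((hu p hp).add (hv p hp)).of_nonneg_of_le
    (fun _ ↦ apply_nonneg p _) fun _ ↦ map_add_le_add p _ _
  smul_mem' := fun c v hv p hp ↦ by
    simpa only [Pi.smul_apply, map_smul_eq_mul] using (hv p hp).mul_left ‖c‖

variable [UniformSpace X] [IsUniformAddGroup X] [ContinuousSMul ℂ X]

theorem denseRange_circle_exp_ratCast :
    DenseRange fun q : ℚ ↦ Circle.exp (2 * Real.pi * (q : ℝ)) := by
  have h : Function.Surjective fun t : ℝ ↦ Circle.exp (2 * Real.pi * t) := fun z ↦ by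
    obtain ⟨t, rfl⟩ := Circle.exp_surjective z
    exact ⟨t / (2 * Real.pi), by simp only; congr 1; field_simp⟩
  exact h.denseRange.comp Rat.denseRange_cast (by fun_prop)

theorem circle_exp_ratCast_pow_den (q : ℚ) : Circle.exp (2 * Real.pi * (q : ℝ)) ^ q.den = 1 := by
  rw [← Circle.exp_nsmul, nsmul_eq_mul, ← Circle.exp_two_pi_mul_int q.num]
  congr 1
  have : (q : ℝ) * q.den = q.num := by exact_mod_cast q.mul_den_eq_num
  linear_combination (2 * Real.pi) * this

/-- Periodic vectors form a subspace, as products of periods are common periods. It contains the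
eigenvectors at roots of unity, and by continuity of the fields its closure contains all `E j z`. -/
theorem dense_periodic_of_eigenvectorField {S : X →L[ℂ] X} {J : Type*} {E : J → Circle → X}
    (hE : ∀ j, Continuous (E j)) (hS : ∀ j z, S (E j z) = (z : ℂ) • E j z)
    (hd : Dense (Submodule.span ℂ {x : X | ∃ (j : J) (z : Circle), E j z = x} : Set X)) :
    Dense {x : X | ∃ n : ℕ, 1 ≤ n ∧ (S ^ n) x = x} := by
  have hmul {x : X} {n : ℕ} (h : (S ^ n) x = x) (m : ℕ) : (S ^ (n * m)) x = x := by
    induction m with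
    | zero => simp
    | succ m ih => rw [mul_add, mul_one, pow_add, mul_apply_eq_comp, h, ih]
  let M : Submodule ℂ X :=
    { carrier := {x : X | ∃ n : ℕ, 1 ≤ n ∧ (S ^ n) x = x}
      zero_mem' := ⟨1, le_rfl, map_zero _⟩
      add_mem' := by
        rintro x y ⟨m, hm, hx⟩ ⟨n, hn, hy⟩
        refine ⟨m * n, Nat.mul_pos hm hn, ?_⟩
        rw [map_add, hmul hx, mul_comm m n, hmul hy]
      smul_mem' := by
        rintro c x ⟨n, hn, hx⟩
        exact ⟨n, hn, by rw [map_smul, hx]⟩ }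
  have hpow (j z) (n : ℕ) : (S ^ n) (E j z) = (z : ℂ) ^ n • E j z := by
    induction n with
    | zero => simp
    | succ n ih => rw [pow_succ, mul_apply_eq_comp, hS, map_smul, ih, smul_smul, pow_succ']
  suffices h : Submodule.span ℂ {x : X | ∃ (j : J) (z : Circle), E j z = x} ≤
      M.topologicalClosure from (hd.mono h).of_closure
  refine Submodule.span_le.2 ?_
  rintro _ ⟨j, z, rfl⟩
  refine closure_mono ?_ ((hE j).range_subset_closure_image_dense denseRange_circle_exp_ratCast ⟨z, rfl⟩)
  rintro _ ⟨_, ⟨q, rfl⟩, rfl⟩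
  refine ⟨q.den, q.den_pos, ?_⟩
  rw [hpow, ← Circle.coe_pow, circle_exp_ratCast_pow_den, Circle.coe_one, one_smul]

variable [PolynormableSpace ℂ X] [CompleteSpace X] [T2Space X]

/-- The points on bi-infinite orbits in `P` are dense if the moments of a spanning family of
eigenvector fields belong to `P`. -/
theorem dense_biorbit_of_circleMoment_mem {S : X →L[ℂ] X} {J : Type*} {E : J → Circle → X}
    (hE : ∀ j, Continuous (E j)) (hS : ∀ j z, S (E j z) = (z : ℂ) • E j z)
    (hd : Dense (Submodule.span ℂ {x : X | ∃ (j : J) (z : Circle), E j z = x} : Set X))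
    {P : Submodule ℂ (ℤ → X)} (hP : ∀ j k, (fun i ↦ circleMoment (E j) (i + k)) ∈ P) :
    Dense ((biorbitSubmodule S ⊓ P).map (LinearMap.proj 0 : (ℤ → X) →ₗ[ℂ] X) : Set X) := by
  refine (dense_span_circleMoment hE hd).mono (Submodule.span_le.2 ?_)
  rintro _ ⟨j, k, rfl⟩
  have h : IsBiorbit S (circleMoment (E j)) := map_circleMoment_of_eigen S (hE j) (hS j)
  exact ⟨_, ⟨h.comp_add k, hP j k⟩, by simp⟩

/-- For null bi-infinite orbits `α`, `β` through points of `U` and `V`, the vectors `α 0 + β (-n)`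
tend to `α 0`, and their images `α n + β 0` under `S ^ n` tend to `β 0`. -/
theorem topologicallyMixing_of_eigenvectorField {S : X →L[ℂ] X} {J : Type*} {E : J → Circle → X}
    (hE : ∀ j, Continuous (E j)) (hS : ∀ j z, S (E j z) = (z : ℂ) • E j z)
    (hd : Dense (Submodule.span ℂ {x : X | ∃ (j : J) (z : Circle), E j z = x} : Set X))
    {U V : Set X} (hU : IsOpen U) (hU' : U.Nonempty) (hV : IsOpen V) (hV' : V.Nonempty) :
    ∃ n₀ : ℕ, ∀ n ≥ n₀, ∃ x ∈ U, (S ^ n) x ∈ V := by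
  have hM := dense_biorbit_of_circleMoment_mem hE hS hd (P := nullFamilySubmodule X) fun j k ↦
    (tendsto_circleMoment_cofinite (hE j)).comp (add_left_injective k).tendsto_cofinite
  obtain ⟨_, ⟨α, ⟨hα, hα0⟩, rfl⟩, haU⟩ := hM.exists_mem_open hU hU'
  obtain ⟨_, ⟨β, ⟨hβ, hβ0⟩, rfl⟩, hbV⟩ := hM.exists_mem_open hV hV'
  have h1 : Tendsto (fun n : ℕ ↦ α 0 + β (-n)) atTop (𝓝 (α 0 + 0)) := by
    rw [← Nat.cofinite_eq_atTop]
    exact (Tendsto.comp (g := β) hβ0 (Function.Injective.tendsto_cofinite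
      fun m n h ↦ by simpa using h)).const_add _
  have h2 : Tendsto (fun n : ℕ ↦ α n + β 0) atTop (𝓝 (0 + β 0)) := by
    rw [← Nat.cofinite_eq_atTop]
    exact (Tendsto.comp (g := α) hα0 (Function.Injective.tendsto_cofinite
      fun m n h ↦ by simpa using h)).add_const _
  rw [add_zero] at h1
  rw [zero_add] at h2
  obtain ⟨n₀, h⟩ := eventually_atTop.1
    ((h1.eventually (hU.mem_nhds haU)).and (h2.eventually (hV.mem_nhds hbV)))
  refine ⟨n₀, fun n hn ↦ ⟨_, (h n hn).1, ?_⟩⟩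
  rw [map_add, IsBiorbit.pow_apply hα, IsBiorbit.pow_apply hβ, zero_add,
    neg_add_cancel]
  exact (h n hn).2

variable [SecondCountableTopology X]

/-- Birkhoff's transitivity argument: by mixing, the points whose orbit meets a given basic open set
form a dense open set, and Baire intersects countably many of these. -/
theorem hypercyclic_of_eigenvectorField {S : X →L[ℂ] X} {J : Type*} {E : J → Circle → X}
    (hE : ∀ j, Continuous (E j)) (hS : ∀ j z, S (E j z) = (z : ℂ) • E j z)
    (hd : Dense (Submodule.span ℂ {x : X | ∃ (j : J) (z : Circle), E j z = x} : Set X)) :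
    ∃ x : X, Dense (Set.range fun n : ℕ ↦ (S ^ n) x) := by
  have : (uniformity X).IsCountablyGenerated := IsUniformAddGroup.uniformity_countably_generated
  have hB := TopologicalSpace.isBasis_countableBasis X
  have hc := TopologicalSpace.countable_countableBasis X
  have hdense := dense_biInter_of_isOpen (f := fun B : Set X ↦ ⋃ n : ℕ, (S ^ n) ⁻¹' B)
    (fun B h ↦ isOpen_iUnion fun n ↦ (hB.isOpen h).preimage (S ^ n).continuous) hc fun B h ↦ by
      rw [dense_iff_inter_open]
      intro U hU hU'
      obtain ⟨n, hn⟩ := topologicallyMixing_of_eigenvectorField hE hS hd hU hU' (hB.isOpen h)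
        (TopologicalSpace.nonempty_of_mem_countableBasis h)
      obtain ⟨x, hx, hxB⟩ := hn n le_rfl
      exact ⟨x, hx, Set.mem_iUnion.2 ⟨n, hxB⟩⟩
  obtain ⟨x, hx⟩ := hdense.nonempty
  refine ⟨x, dense_iff_inter_open.2 fun U hU ⟨y, hy⟩ ↦ ?_⟩
  obtain ⟨B, hBm, hyB, hBU⟩ := hB.exists_subset_of_mem_open hy hU
  obtain ⟨n, hn⟩ := Set.mem_iUnion.1 (Set.mem_iInter₂.1 hx B hBm)
  exact ⟨_, hBU hn, n, rfl⟩

theorem frequentlyHypercyclic_of_eigenvectorField {S : X →L[ℂ] X} {J : Type*}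
    {E : J → Circle → X} (hE : ∀ j, IsCircleC2 (E j)) (hS : ∀ j z, S (E j z) = (z : ℂ) • E j z)
    (hd : Dense (Submodule.span ℂ {x : X | ∃ (j : J) (z : Circle), E j z = x} : Set X)) :
    ∃ x : X, ∀ V : Set X, IsOpen V → V.Nonempty → 0 < natLowerDensity {n | (S ^ n) x ∈ V} := by
  have hM := dense_biorbit_of_circleMoment_mem (fun j ↦ (hE j).continuous) hS hd
    (P := absSummableFamilySubmodule X) fun j k p hp ↦
      ((hE j).summable_circleMoment hp).comp_injective (add_left_injective k)
  obtain ⟨t, htM, htc, htd⟩ := hM.exists_countable_dense_subset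
  obtain ⟨y, rfl⟩ := htc.exists_eq_range htd.nonempty
  choose v hv hvy using fun l ↦ htM (Set.mem_range_self l)
  refine exists_frequentlyHypercyclic_of_biorbit S (fun l ↦ (hv l).1) ?_ fun p hp l ↦ (hv l).2 p hp
  have : (fun l ↦ v l 0) = y := funext hvy
  rwa [this]

end EigenvectorFields

theorem PolynormableSpace.of_locallyConvexSpace_real {X : Type*} [AddCommGroup X] [Module ℂ X]
    [TopologicalSpace X] [IsTopologicalAddGroup X] [ContinuousSMul ℂ X] [LocallyConvexSpace ℝ X] :
    PolynormableSpace ℂ X := by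
  open scoped ComplexOrder in
  have : ContinuousSMul ℝ X := IsScalarTower.continuousSMul (M := ℝ) (α := X) ℂ
  have : LocallyConvexSpace ℂ X := by
    rw [locallyConvexSpace_iff_exists_convex_subset]
    intro x U hU
    obtain ⟨S, hS, hSc, hSU⟩ := (locallyConvexSpace_iff_exists_convex_subset ℝ X).1 ‹_› x U hU
    exact ⟨S, hS, convex_of_nonneg_surjective_algebraMap _
      (fun c hc ↦ RCLike.nonneg_iff_exists_ofReal.mp (show 0 ≤ c from hc)) hSc, hSU⟩
  infer_instance

/-! ### The orbit space of an unbounded operator and its shift -/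

namespace LinearPMap

section Algebra

variable {X : Type*} [AddCommGroup X] [Module ℂ X]

theorem iter_zero_apply (T : X →ₗ.[ℂ] X) (x : X) :
    ∃ h : x ∈ (T.iter 0).domain, T.iter 0 ⟨x, h⟩ = x :=
  ⟨trivial, rfl⟩

theorem mem_iter_succ_of_graph (T : X →ₗ.[ℂ] X) {n : ℕ} {x y z : X}
    (hx : ∃ h : x ∈ (T.iter n).domain, T.iter n ⟨x, h⟩ = y) (hy : (y, z) ∈ T.graph) :
    ∃ h : x ∈ (T.iter (n + 1)).domain, T.iter (n + 1) ⟨x, h⟩ = z := by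
  obtain ⟨hx, rfl⟩ := hx
  obtain ⟨⟨y, hyT⟩, hy1, hy2⟩ := T.mem_graph_iff.1 hy
  simp only at hy1 hy2
  subst hy1
  exact ⟨⟨⟨x, hx⟩, hyT, rfl⟩, hy2⟩

theorem graph_of_mem_iter_succ (T : X →ₗ.[ℂ] X) {n : ℕ} {x : X}
    (h : x ∈ (T.iter n).domain) (h' : x ∈ (T.iter (n + 1)).domain) :
    (T.iter n ⟨x, h⟩, T.iter (n + 1) ⟨x, h'⟩) ∈ T.graph := by
  obtain ⟨⟨y, hy⟩, hyT, rfl⟩ := id h'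
  exact T.mem_graph_iff.2 ⟨⟨_, hyT⟩, rfl, rfl⟩

/-- The space of forward orbits `(x, T x, T² x, …)` of an operator. -/
def orbitSubmodule (T : X →ₗ.[ℂ] X) : Submodule ℂ (ℕ → X) where
  carrier := {f | ∀ n, (f n, f (n + 1)) ∈ T.graph}
  zero_mem' := fun _ ↦ T.graph.zero_mem
  add_mem' := fun hf hg n ↦ T.graph.add_mem (hf n) (hg n)
  smul_mem' := fun c _ hf n ↦ T.graph.smul_mem c (hf n)

theorem iter_apply_of_mem_orbitSubmodule (T : X →ₗ.[ℂ] X) {f : ℕ → X}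
    (hf : f ∈ T.orbitSubmodule) (n : ℕ) :
    ∃ h : f 0 ∈ (T.iter n).domain, T.iter n ⟨f 0, h⟩ = f n := by
  induction n with
  | zero => exact T.iter_zero_apply _
  | succ n ih => exact T.mem_iter_succ_of_graph ih (hf n)

theorem mem_domInfty_of_mem_orbitSubmodule (T : X →ₗ.[ℂ] X) {f : ℕ → X}
    (hf : f ∈ T.orbitSubmodule) : f 0 ∈ T.domInfty :=
  (Submodule.mem_iInf _).2 fun n ↦ (T.iter_apply_of_mem_orbitSubmodule hf n).1

theorem powInfty_of_mem_orbitSubmodule (T : X →ₗ.[ℂ] X) {f : ℕ → X}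
    (hf : f ∈ T.orbitSubmodule) (n : ℕ) :
    T.powInfty n ⟨f 0, T.mem_domInfty_of_mem_orbitSubmodule hf⟩ = f n :=
  (T.iter_apply_of_mem_orbitSubmodule hf n).2

theorem orbitSubmodule_ext (T : X →ₗ.[ℂ] X) {f g : ℕ → X} (hf : f ∈ T.orbitSubmodule)
    (hg : g ∈ T.orbitSubmodule) (h : f 0 = g 0) : f = g := by
  ext n
  induction n with
  | zero => exact h
  | succ n ih =>
    have := hf n
    rw [ih] at this
    exact T.mem_graph_snd_inj this (hg n) rfl

/-- The orbit of a point of `D_∞(T)`. -/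
def orbitOf (T : X →ₗ.[ℂ] X) (x : T.domInfty) : T.orbitSubmodule :=
  ⟨fun n ↦ T.powInfty n x, fun n ↦
    T.graph_of_mem_iter_succ (T.domInfty_le n x.2) (T.domInfty_le (n + 1) x.2)⟩

theorem orbitOf_surjective (T : X →ₗ.[ℂ] X) : Function.Surjective T.orbitOf := fun f ↦
  ⟨⟨f.1 0, T.mem_domInfty_of_mem_orbitSubmodule f.2⟩,
    Subtype.ext (funext fun n ↦ T.powInfty_of_mem_orbitSubmodule f.2 n)⟩

theorem eigenvector_mem_orbitSubmodule (T : X →ₗ.[ℂ] X) {x : X} {c : ℂ}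
    (h : ∃ h : x ∈ T.domain, T ⟨x, h⟩ = c • x) : (fun n ↦ c ^ n • x) ∈ T.orbitSubmodule := by
  intro n
  obtain ⟨hx, h⟩ := h
  have : (x, c • x) ∈ T.graph := T.mem_graph_iff.2 ⟨⟨x, hx⟩, rfl, h⟩
  have := T.graph.smul_mem (c ^ n) this
  rwa [Prod.smul_mk, smul_smul, ← pow_succ] at this

end Algebra

section Topology

variable {X : Type*} [AddCommGroup X] [Module ℂ X]

/-- With the resolvent `R` at `c`, the graph is the set of `(x, y)` satisfying the continuous
equation `R (c x - y) = x`. -/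
theorem isClosed_graph_of_resolventSet_nonempty [TopologicalSpace X] [IsTopologicalAddGroup X]
    [ContinuousSMul ℂ X] [T2Space X] {T : X →ₗ.[ℂ] X} (h : T.resolventSet.Nonempty) :
    _root_.IsClosed (T.graph : Set (X × X)) := by
  obtain ⟨c, R, h1, h2⟩ := h
  have : (T.graph : Set (X × X)) = {q | R (c • q.1 - q.2) = q.1} := by
    ext ⟨x, y⟩
    constructor
    · intro h
      obtain ⟨x, rfl, rfl⟩ := T.mem_graph_iff.1 h
      exact h2 x
    · intro h
      obtain ⟨h3, h4⟩ := h1 (c • x - y)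
      refine T.mem_graph_iff.2 ⟨⟨_, h3⟩, h, ?_⟩
      have h5 : R (c • x - y) = x := h
      simp only [h5] at h4 ⊢
      exact sub_right_injective h4
  rw [this]
  exact isClosed_eq (by fun_prop) (by fun_prop)

theorem isClosed_orbitSubmodule [TopologicalSpace X] {T : X →ₗ.[ℂ] X}
    (h : _root_.IsClosed (T.graph : Set (X × X))) :
    _root_.IsClosed (T.orbitSubmodule : Set (ℕ → X)) := by
  have : (T.orbitSubmodule : Set (ℕ → X)) =
      ⋂ n, (fun f : ℕ → X ↦ (f n, f (n + 1))) ⁻¹' T.graph := by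
    ext f
    simp only [Set.mem_iInter, Set.mem_preimage, SetLike.mem_coe]
    rfl
  rw [this]
  exact isClosed_iInter fun n ↦ h.preimage (by fun_prop)

/-- The shift on the space of orbits. -/
def orbitShift [TopologicalSpace X] (T : X →ₗ.[ℂ] X) : T.orbitSubmodule →L[ℂ] T.orbitSubmodule where
  toFun f := ⟨fun n ↦ f.1 (n + 1), fun n ↦ f.2 (n + 1)⟩
  map_add' _ _ := rfl
  map_smul' _ _ := rfl
  cont := by
    refine Continuous.subtype_mk (continuous_pi fun n ↦ ?_) _
    exact (continuous_apply (A := fun _ : ℕ ↦ X) (n + 1)).comp continuous_subtype_val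

theorem orbitShift_apply [TopologicalSpace X] (T : X →ₗ.[ℂ] X) (f : T.orbitSubmodule) (m : ℕ) :
    (T.orbitShift f).1 m = f.1 (m + 1) :=
  rfl

theorem orbitShift_pow_apply [TopologicalSpace X] (T : X →ₗ.[ℂ] X) (n : ℕ) (f : T.orbitSubmodule)
    (m : ℕ) : ((T.orbitShift ^ n) f).1 m = f.1 (m + n) := by
  induction n generalizing m with
  | zero => simp
  | succ n ih =>
    rw [pow_succ', mul_apply_eq_comp, orbitShift_apply, ih, add_assoc, add_comm 1 n]

theorem continuous_orbitOf [TopologicalSpace X] (T : X →ₗ.[ℂ] X) :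
    @Continuous _ _ T.domInftyTopology _ T.orbitOf := by
  let _ := T.domInftyTopology
  exact Continuous.subtype_mk (continuous_pi fun n ↦
    continuous_iInf_dom continuous_induced_dom) _

/-- Transports the density hypothesis on `⋃ R(D_s)` from `[D_∞(T)]` to the orbit space. -/
theorem dense_orbitOf_image [TopologicalSpace X] (T : X →ₗ.[ℂ] X) {s : Set T.domInfty}
    (hs : @Dense _ T.domInftyTopology s) : Dense (T.orbitOf '' s) := by
  let _ := T.domInftyTopology
  exact T.orbitOf_surjective.denseRange.dense_image T.continuous_orbitOf hs

/-- An operator mapping into `D_∞(T)`, all of whose compositions with powers of `T` are continuous,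
is continuous as an operator into the space of orbits. -/
theorem exists_lift_orbitSubmodule [TopologicalSpace X] (T : X →ₗ.[ℂ] X) (D : X →L[ℂ] X)
    (h : ∀ n : ℕ, ∃ B : X →L[ℂ] X, ∀ x : X,
      ∃ h : D x ∈ (T.iter n).domain, T.iter n ⟨D x, h⟩ = B x) :
    ∃ L : X →L[ℂ] T.orbitSubmodule, ∀ x, (L x).1 0 = D x := by
  choose B hB using h
  refine ⟨(ContinuousLinearMap.pi B).codRestrict T.orbitSubmodule fun x n ↦ ?_, fun x ↦ ?_⟩
  · obtain ⟨h1, h2⟩ := hB n x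
    obtain ⟨h3, h4⟩ := hB (n + 1) x
    have := T.graph_of_mem_iter_succ h1 h3
    rwa [h2, h4] at this
  · obtain ⟨h1, h2⟩ := hB 0 x
    exact h2.symm

end Topology

end LinearPMap

/-! ### Transfer from the orbit space to `T` -/

theorem theorem3p7 {X : Type*} [AddCommGroup X] [Module ℂ X] [UniformSpace X]
    [IsUniformAddGroup X] [ContinuousSMul ℂ X] [LocallyConvexSpace ℝ X]
    [TopologicalSpace.MetrizableSpace X] [CompleteSpace X] [TopologicalSpace.SeparableSpace X]
    (T : X →ₗ.[ℂ] X) (hdense : Dense (T.domain : Set X)) (hres : T.resolventSet.Nonempty)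
    {J : Type*} [Nonempty J] (E : J → Circle → X)
    (hE : ∀ (j : J) (z : Circle), ∃ h : E j z ∈ T.domain, T ⟨E j z, h⟩ = (z : ℂ) • E j z)
    (hspan : Dense (Submodule.span ℂ {x : X | ∃ (j : J) (z : Circle), E j z = x} : Set X))
    (D : ℕ → X →L[ℂ] X)
    (hcomm : ∀ (s : ℕ) (x : T.domain), ∃ h : D s x ∈ T.domain, T ⟨D s x, h⟩ = D s (T x))
    (hpow : ∀ s n : ℕ, ∃ B : X →L[ℂ] X, ∀ x : X,
      ∃ h : D s x ∈ (T.iter n).domain, T.iter n ⟨D s x, h⟩ = B x)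
    (hrange : @Dense T.domInfty T.domInftyTopology {y | ∃ (s : ℕ) (x : X), D s x = y}) :
    ((∀ j, Continuous (E j)) → T.IsTopologicallyMixing ∧ T.IsChaotic) ∧
    ((∀ j, IsCircleC2 (E j)) → T.IsFrequentlyHypercyclic) := by
  have : PolynormableSpace ℂ X := .of_locallyConvexSpace_real
  have : SecondCountableTopology X := by
    have : (uniformity X).IsCountablyGenerated := IsUniformAddGroup.uniformity_countably_generated
    exact UniformSpace.secondCountable_of_separable X
  let Y := T.orbitSubmodule
  have : IsUniformAddGroup Y := inferInstanceAs (IsUniformAddGroup Y.toAddSubgroup)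
  have : SecondCountableTopology Y :=
    TopologicalSpace.Subtype.secondCountableTopology (Y : Set (ℕ → X))
  have : CompleteSpace Y := (T.isClosed_orbitSubmodule
    (T.isClosed_graph_of_resolventSet_nonempty hres)).completeSpace_coe
  choose L hL using fun s ↦ T.exists_lift_orbitSubmodule (D s) (hpow s)
  let F : ℕ × J → Circle → Y := fun a z ↦ L a.1 (E a.2 z)
  have hF (a z) : T.orbitShift (F a z) = (z : ℂ) • F a z := by
    have hz : ∃ h : D a.1 (E a.2 z) ∈ T.domain,
        T ⟨D a.1 (E a.2 z), h⟩ = (z : ℂ) • D a.1 (E a.2 z) := by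
      obtain ⟨h1, h2⟩ := hE a.2 z
      obtain ⟨h3, h4⟩ := hcomm a.1 ⟨_, h1⟩
      exact ⟨h3, by rw [h4, h2, map_smul]⟩
    -- An orbit is determined by its first entry, and `D_s E_j(z)` is an eigenvector of `T`, so its
    -- orbit is geometric.
    have h := T.orbitSubmodule_ext (F a z).2 (T.eigenvector_mem_orbitSubmodule hz)
      (by rw [pow_zero, one_smul, hL])
    ext n
    rw [T.orbitShift_apply, Submodule.coe_smul, Pi.smul_apply, h]
    simp only
    rw [pow_succ', mul_smul]
  -- Orbits of points of `⋃ R(D_s)` are dense in `Y`. Each has the form `L s x`, and is approximated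
  -- by approximating `x` in the span of the `E j z`.
  have hd : Dense (Submodule.span ℂ {y : Y | ∃ (a : ℕ × J) (z : Circle), F a z = y} : Set Y) := by
    have hDY := T.dense_orbitOf_image hrange
    refine (hDY.mono ?_).of_closure
    rintro _ ⟨y, ⟨s, x, hx⟩, rfl⟩
    have hyx : T.orbitOf y = L s x := Subtype.ext <| T.orbitSubmodule_ext (T.orbitOf y).2 (L s x).2
      ((T.iter_zero_apply y).2.trans (hx.symm.trans (hL s x).symm))
    rw [hyx]
    refine map_mem_closure (L s).continuous (hspan x) fun e he ↦ ?_
    have : Submodule.span ℂ {x : X | ∃ (j : J) (z : Circle), E j z = x} ≤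
        (Submodule.span ℂ {y : Y | ∃ (a : ℕ × J) (z : Circle), F a z = y}).comap
          (L s : X →ₗ[ℂ] Y) := by
      refine Submodule.span_le.2 ?_
      rintro _ ⟨j, z, rfl⟩
      exact Submodule.subset_span ⟨(s, j), z, rfl⟩
    exact this he
  let ev : Y →L[ℂ] X := (ContinuousLinearMap.proj 0).comp Y.subtypeL
  -- Every `E j z` is the first entry of its own geometric orbit, so the range contains their dense
  -- span.
  have hev : DenseRange ev := by
    refine hspan.mono ?_
    change ((Submodule.span ℂ _ : Submodule ℂ X) : Set X) ⊆ (ev.range : Submodule ℂ X)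
    refine Submodule.span_le.2 ?_
    rintro _ ⟨j, z, rfl⟩
    exact ⟨⟨_, T.eigenvector_mem_orbitSubmodule (hE j z)⟩, by simp [ev]⟩
  have hev_pow (n : ℕ) (f : Y) : ev ((T.orbitShift ^ n) f) = f.1 n :=
    (T.orbitShift_pow_apply n f 0).trans (by rw [zero_add])
  have hpowInfty (n : ℕ) (f : Y) : T.powInfty n ⟨f.1 0, T.mem_domInfty_of_mem_orbitSubmodule f.2⟩ =
      ev ((T.orbitShift ^ n) f) :=
    (T.powInfty_of_mem_orbitSubmodule f.2 n).trans (hev_pow n f).symm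
  have hpre {V : Set X} (hV : IsOpen V) (hV' : V.Nonempty) :
      IsOpen (ev ⁻¹' V) ∧ (ev ⁻¹' V).Nonempty :=
    ⟨hV.preimage ev.continuous, let ⟨f, hf⟩ := hev.exists_mem_open hV hV'; ⟨f, hf⟩⟩
  refine ⟨fun hc ↦ ?_, fun hc ↦ ?_⟩
  · have hFc (a) : Continuous (F a) := (L a.1).continuous.comp (hc a.2)
    refine ⟨fun U V hU hU' hV hV' ↦ ?_, ?_, ?_⟩
    · obtain ⟨n₀, h⟩ := topologicallyMixing_of_eigenvectorField hFc hF hd (hpre hU hU').1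
        (hpre hU hU').2 (hpre hV hV').1 (hpre hV hV').2
      refine ⟨n₀, fun n hn ↦ ?_⟩
      obtain ⟨f, hfU, hfV⟩ := h n hn
      obtain ⟨h1, h2⟩ := T.iter_apply_of_mem_orbitSubmodule f.2 n
      refine ⟨⟨f.1 0, h1⟩, hfU, ?_⟩
      rw [h2, ← hev_pow]
      exact hfV
    · obtain ⟨f, hf⟩ := hypercyclic_of_eigenvectorField hFc hF hd
      refine ⟨⟨f.1 0, T.mem_domInfty_of_mem_orbitSubmodule f.2⟩, ?_⟩
      simp only [hpowInfty]
      have := hev.dense_image ev.continuous hf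
      rwa [← Set.range_comp] at this
    · refine (hev.dense_image ev.continuous
        (dense_periodic_of_eigenvectorField hFc hF hd)).mono ?_
      rintro _ ⟨f, ⟨n, hn, hf⟩, rfl⟩
      refine ⟨T.mem_domInfty_of_mem_orbitSubmodule f.2, n, hn, ?_⟩
      exact (hpowInfty n f).trans (by rw [hf])
  · obtain ⟨f, hf⟩ := frequentlyHypercyclic_of_eigenvectorField
      (fun a : ℕ × J ↦ (hc a.2).map (L a.1)) hF hd
    refine ⟨⟨f.1 0, T.mem_domInfty_of_mem_orbitSubmodule f.2⟩, fun V hV hV' ↦ ?_⟩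
    have h := hf _ (hpre hV hV').1 (hpre hV hV').2
    simpa only [hpowInfty, Set.mem_preimage] using h
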